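/- Let $m\ge 2$, let $e_1,\dots,e_m$ be an orthonormal basis of an $m$-dimensional complex Hilbert space $\mathcal H$, and put $e_0=\frac1{\sqrt m}\sum_{j=1}^m e_j$. Let $r_0\ge r_1\ge 0$ with $r_0+(m-1)r_1=1$, and let $$\psi_j=\sqrt{m r_1}\,e_j+(\sqrt{r_0}-\sqrt{r_1})\,e_0,\qquad j=1,\dots,m,$$ be the edges of the corresponding acute quantum pyramid (the orthogonal case $r_0=r_1$ and the degenerate case $r_1=0$ are included). Let $\mathcal E=\{\pi_j,\rho_j\}$ be the ensemble with $\pi_j=\frac1m$, $\rho_j=|\psi_j\rangle\langle\psi_j|$. For an observable $\mathcal M=\{M_k\}_{k}$ (finitely many operators $M_k\ge0$ on $\mathcal H$ with $\sum_kM_k=I$) put $p_{jk}=\pi_j\,\mathrm{Tr}\,\rho_jM_k$, $p_k=\sum_jp_{jk}$ and $I(\mathcal E,\mathcal M)=\sum_{j,k}p_{jk}\log\frac{p_{jk}}{\pi_jp_k}$, where $\log$ is the binary logarithm and $0\log(\cdot)=0$, and let $A(\mathcal E)=\sup_{\mathcal M}I(\mathcal E,\mathcal M)$ be the accessible information. Let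 $$t_a(m)=\begin{cases}1,& r_0\le \frac{4(m-1)}{m^2},\\[2pt] \frac{2(m-1)}{m-2}\sqrt{\frac{r_1}{r_0}},& r_0>\frac{4(m-1)}{m^2},\end{cases}$$ where the second case occurs only for $m\ge3$. Then $0\le t_a(m)\le1$, and, with $t=t_a(m)$, the Englert–Řeháček observable $M_k=|\tilde e_k\rangle\langle\tilde e_k|$, $k=0,1,\dots,m$, where $$\tilde e_0=\sqrt{1-t^2}\,e_0,\qquad \tilde e_k=e_k+\frac{t-1}{\sqrt m}\,e_0\quad(k=1,\dots,m),$$ is information-optimal: it attains $A(\mathcal E)$. Moreover, let $p=a^2$ with $a=\sqrt{mr_1}+\frac{\sqrt{r_0}-\sqrt{r_1}}{\sqrt m}=\langle e_j|\psi_j\rangle$. Then $p\in[\frac1m,1]$ and $$A(\mathcal E)=\begin{cases}\log m+p\log p+(1-p)\log\frac{1-p}{m-1},& p\in\left[\frac{m-1}m,1\right],\\[4pt] \frac{m-1}{m-2}\,\log(m-1)\left(\sqrt p-\sqrt{\frac{1-p}{m-1}}\right)^2,& m\ge3,\ p\in\left[\frac1m,\frac{m-1}m\right].\end{cases}$$ Equivalently,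 as conjectured by Englert and Řeháček, $$A(\mathcal E)=\begin{cases}\frac1m\left(\sqrt{r_0}+(m-1)\sqrt{r_1}\right)^2\log\left(\sqrt{r_0}+(m-1)\sqrt{r_1}\right)^2+\frac{m-1}m\left(\sqrt{r_0}-\sqrt{r_1}\right)^2\log\left(\sqrt{r_0}-\sqrt{r_1}\right)^2,& r_0\le\frac{4(m-1)}{m^2},\\[4pt] \frac{m(1-r_0)}{m-2}\log(m-1),& r_0>\frac{4(m-1)}{m^2}.\end{cases}$$ -/

import Mathlib

noncomputable section

/-- A finite ensemble `{π_j, ρ_j}`, `j = 1, …, m`, of quantum states on a finite-dimensional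
Hilbert space: a probability distribution together with density operators. -/
structure QEnsemble (H : Type*) [NormedAddCommGroup H] [InnerProductSpace ℂ H]
    [FiniteDimensional ℂ H] (m : ℕ) where
  prob : Fin m → ℝ
  state : Fin m → (H →L[ℂ] H)
  prob_nonneg : ∀ j, 0 ≤ prob j
  prob_sum : ∑ j, prob j = 1
  state_pos : ∀ j, (state j).IsPositive
  state_trace : ∀ j, LinearMap.trace ℂ H (state j).toLinearMap = 1

/-- A quantum observable with `n` outcomes: a resolution of the identity into positive
operators. -/
structure QObservable (H : Type*) [NormedAddCommGroup H] [InnerProductSpace ℂ H]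
    [FiniteDimensional ℂ H] (n : ℕ) where
  effect : Fin n → (H →L[ℂ] H)
  effect_pos : ∀ k, (effect k).IsPositive
  effect_sum : ∑ k, effect k = ContinuousLinearMap.id ℂ H

section Information

variable {H : Type*} [NormedAddCommGroup H] [InnerProductSpace ℂ H] [FiniteDimensional ℂ H]
  {m n : ℕ}

/-- The joint distribution `p_{jk} = π_j Tr ρ_j M_k` of input `j` and output `k`. -/
def jointProb (E : QEnsemble H m) (M : QObservable H n) (j : Fin m) (k : Fin n) : ℝ :=
  E.prob j * (LinearMap.trace ℂ H (E.state j ∘L M.effect k).toLinearMap).re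

/-- The distribution `p_k = ∑_j p_{jk}` of the output. -/
def outputProb (E : QEnsemble H m) (M : QObservable H n) (k : Fin n) : ℝ :=
  ∑ j, jointProb E M j k

/-- The Shannon mutual information (in bits) between input and output. The conventions
`x / 0 = 0` and `Real.logb 2 0 = 0` make the terms with `p_{jk} = 0` vanish, as usual. -/
def mutualInformation (E : QEnsemble H m) (M : QObservable H n) : ℝ :=
  ∑ j, ∑ k, jointProb E M j k *
    Real.logb 2 (jointProb E M j k / (E.prob j * outputProb E M k))

/-- The accessible information: the supremum of the mutual information over all observables
with any finite number of outcomes. -/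
def accessibleInformation (E : QEnsemble H m) : ℝ :=
  sSup {x : ℝ | ∃ (n : ℕ) (M : QObservable H n), x = mutualInformation E M}

/-- `M` is (globally) information-optimal for `E`: no observable, with any finite number of
outcomes, yields more mutual information. -/
def IsInformationOptimal (E : QEnsemble H m) (M : QObservable H n) : Prop :=
  ∀ (n' : ℕ) (N : QObservable H n'), mutualInformation E N ≤ mutualInformation E M

end Information

section Pyramid

variable {H : Type*} [NormedAddCommGroup H] [InnerProductSpace ℂ H] {m : ℕ}

/-- The symmetry axis `e₀ = m^{-1/2} ∑_j e_j`. -/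
def pyramidAxis (e : OrthonormalBasis (Fin m) ℂ H) : H :=
  (((1 / √(m : ℝ) : ℝ)) : ℂ) • ∑ j, e j

/-- The edges `ψ_j = √(m r₁) e_j + (√r₀ - √r₁) e₀` of the quantum pyramid. -/
def pyramidVector (e : OrthonormalBasis (Fin m) ℂ H) (r₀ r₁ : ℝ) (j : Fin m) : H :=
  ((√((m : ℝ) * r₁) : ℝ) : ℂ) • e j + ((√r₀ - √r₁ : ℝ) : ℂ) • pyramidAxis e

/-- The vectors `ẽ₀ = √(1 - t²) e₀` (index `0`) and `ẽ_k = e_k + ((t - 1) / √m) e₀`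
(index `k.succ`). -/
def erVector (e : OrthonormalBasis (Fin m) ℂ H) (t : ℝ) : Fin (m + 1) → H :=
  Fin.cons (((√(1 - t ^ 2) : ℝ) : ℂ) • pyramidAxis e)
    (fun k : Fin m => e k + (((t - 1) / √(m : ℝ) : ℝ) : ℂ) • pyramidAxis e)

theorem inner_basis_axis (e : OrthonormalBasis (Fin m) ℂ H) (j : Fin m) :
    inner ℂ (e j) (pyramidAxis e) = (((1 / √(m : ℝ) : ℝ)) : ℂ) := by
  simp [pyramidAxis, e.inner_eq_ite]

theorem inner_axis_basis (e : OrthonormalBasis (Fin m) ℂ H) (j : Fin m) :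
    inner ℂ (pyramidAxis e) (e j) = (((1 / √(m : ℝ) : ℝ)) : ℂ) := by
  rw [← inner_conj_symm, inner_basis_axis, Complex.conj_ofReal]

theorem sum_basis (e : OrthonormalBasis (Fin m) ℂ H) (hm : 2 ≤ m) :
    ∑ j, e j = ((√(m : ℝ) : ℝ) : ℂ) • pyramidAxis e := by
  have h : √(m : ℝ) ≠ 0 := by positivity
  rw [pyramidAxis, smul_smul, ← Complex.ofReal_mul, mul_one_div_cancel h, Complex.ofReal_one,
    one_smul]

theorem inner_axis_axis (e : OrthonormalBasis (Fin m) ℂ H) (hm : 2 ≤ m) :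
    inner ℂ (pyramidAxis e) (pyramidAxis e) = (1 : ℂ) := by
  have h0 : (0 : ℝ) < m := by positivity
  have h1 : (m : ℝ) * (1 / √(m : ℝ) * (1 / √(m : ℝ))) = 1 := by
    rw [div_mul_div_comm, Real.mul_self_sqrt h0.le]; field_simp
  nth_rw 2 [pyramidAxis]
  rw [inner_smul_right, inner_sum]
  simp only [inner_axis_basis, Finset.sum_const, Finset.card_univ, Fintype.card_fin,
    nsmul_eq_mul]
  calc _ = (((m : ℝ) * (1 / √(m : ℝ) * (1 / √(m : ℝ))) : ℝ) : ℂ) := by push_cast; ring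
    _ = 1 := by rw [h1, Complex.ofReal_one]

theorem inner_pyramidVector_self (e : OrthonormalBasis (Fin m) ℂ H) (hm : 2 ≤ m) {r₀ r₁ : ℝ}
    (hr₀ : 0 ≤ r₀) (hr₁ : 0 ≤ r₁) (hr : r₀ + ((m : ℝ) - 1) * r₁ = 1) (j : Fin m) :
    inner ℂ (pyramidVector e r₀ r₁ j) (pyramidVector e r₀ r₁ j) = (1 : ℂ) := by
  have h0 : (0 : ℝ) < m := by positivity
  have hs : √(m : ℝ) ≠ 0 := by positivity
  simp only [pyramidVector, inner_add_left, inner_add_right, inner_smul_left, inner_smul_right,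
    inner_basis_axis, inner_axis_basis, inner_axis_axis e hm, Complex.conj_ofReal,
    e.inner_eq_one]
  have key : √((m : ℝ) * r₁) * √((m : ℝ) * r₁) +
      2 * (√((m : ℝ) * r₁) * (√r₀ - √r₁) * (1 / √(m : ℝ))) + (√r₀ - √r₁) * (√r₀ - √r₁) = 1 := by
    rw [Real.mul_self_sqrt (by positivity), Real.sqrt_mul h0.le]
    have a0 := Real.mul_self_sqrt hr₀
    have a1 := Real.mul_self_sqrt hr₁
    field_simp
    linear_combination hr + a0 - a1
  have key' := congrArg (fun x : ℝ => (x : ℂ)) key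
  push_cast at key' ⊢
  linear_combination key'

variable [FiniteDimensional ℂ H]

/-- The ensemble of `m` equiprobable pure states `|ψ_j⟩⟨ψ_j|` of the quantum pyramid. -/
def pyramidEnsemble (e : OrthonormalBasis (Fin m) ℂ H) (hm : 2 ≤ m) {r₀ r₁ : ℝ}
    (hr₀ : 0 ≤ r₀) (hr₁ : 0 ≤ r₁) (hr : r₀ + ((m : ℝ) - 1) * r₁ = 1) : QEnsemble H m where
  prob := fun _ => 1 / (m : ℝ)
  state := fun j => InnerProductSpace.rankOne ℂ (pyramidVector e r₀ r₁ j) (pyramidVector e r₀ r₁ j)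
  prob_nonneg := fun _ => by positivity
  prob_sum := by
    have h : (m : ℝ) ≠ 0 := by positivity
    simp [h]
  state_pos := fun j => InnerProductSpace.isPositive_rankOne_self _
  state_trace := fun j => by
    rw [InnerProductSpace.trace_rankOne, inner_pyramidVector_self e hm hr₀ hr₁ hr]

/-- The Englert–Řeháček observable `M_k = |ẽ_k⟩⟨ẽ_k|`, `k = 0, 1, …, m`, with parameter
`0 ≤ t ≤ 1`. -/
def erObservable (e : OrthonormalBasis (Fin m) ℂ H) (hm : 2 ≤ m) {t : ℝ}
    (ht : t ∈ Set.Icc (0 : ℝ) 1) : QObservable H (m + 1) where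
  effect := fun k => InnerProductSpace.rankOne ℂ (erVector e t k) (erVector e t k)
  effect_pos := fun k => InnerProductSpace.isPositive_rankOne_self _
  effect_sum := by
    have h0 : (0 : ℝ) < m := by positivity
    have hs : √(m : ℝ) ≠ 0 := by positivity
    have ht2 : 0 ≤ 1 - t ^ 2 := by nlinarith [ht.1, ht.2]
    have h1 := e.sum_rankOne_eq_id
    rw [Fin.sum_univ_succ]
    simp only [erVector, Fin.cons_zero, Fin.cons_succ, map_add, add_apply,
      Finset.sum_add_distrib, h1]
    simp only [map_smulₛₗ, smul_apply, ← Finset.smul_sum, ← map_sum,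
      ← sum_apply, sum_basis e hm, Finset.sum_const, Finset.card_univ,
      Fintype.card_fin, RingHom.id_apply, Complex.conj_ofReal, smul_smul, ← Nat.cast_smul_eq_nsmul ℂ]
    have key : √(1 - t ^ 2) * √(1 - t ^ 2) + 2 * ((t - 1) / √(m : ℝ) * √(m : ℝ)) +
        (m : ℝ) * ((t - 1) / √(m : ℝ) * ((t - 1) / √(m : ℝ))) = 0 := by
      rw [Real.mul_self_sqrt ht2, div_mul_div_comm, Real.mul_self_sqrt h0.le]
      field_simp
      ring
    have key' := congrArg (fun x : ℝ => (x : ℂ)) key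
    push_cast at key' ⊢
    rw [map_natCast]
    generalize InnerProductSpace.rankOne ℂ (pyramidAxis e) (pyramidAxis e) = R
    have hR := congrArg (fun c : ℂ => ContinuousLinearMap.id ℂ H + c • R) key'
    simp only [zero_smul, add_zero] at hR
    refine Eq.trans ?_ hR
    module

end Pyramid

/-- The optimal parameter `t_a(m)` of the observable for an acute pyramid. -/
def optimalParameter (m : ℕ) (r₀ r₁ : ℝ) : ℝ :=
  if r₀ ≤ 4 * ((m : ℝ) - 1) / (m : ℝ) ^ 2 then 1
  else 2 * ((m : ℝ) - 1) / ((m : ℝ) - 2) * √(r₁ / r₀)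

/-- The parameter `p = a²`, where `a = √(m r₁) + (√r₀ - √r₁) / √m = ⟨e_j|ψ_j⟩`. -/
def pyramidP (m : ℕ) (r₀ r₁ : ℝ) : ℝ :=
  (√((m : ℝ) * r₁) + (√r₀ - √r₁) / √(m : ℝ)) ^ 2

/-- The mutual information of the square-root measurement, in terms of `r₀` and `r₁`. -/
def srmInformation (m : ℕ) (r₀ r₁ : ℝ) : ℝ :=
  1 / (m : ℝ) * (√r₀ + ((m : ℝ) - 1) * √r₁) ^ 2 *
      Real.logb 2 ((√r₀ + ((m : ℝ) - 1) * √r₁) ^ 2)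
    + ((m : ℝ) - 1) / (m : ℝ) * (√r₀ - √r₁) ^ 2 * Real.logb 2 ((√r₀ - √r₁) ^ 2)

end

/-!
For an ensemble of equiprobable pure states `ψⱼ`, an observable `M` enters the mutual information
only through the amplitudes `xₗⱼ = ‖M_l^{1/2} ψⱼ‖`: up to the constant `log m`, the information is
the average over the outcomes `l` of the negative entropy of the distribution proportional to
`(xₗⱼ²)ⱼ`. The triangle inequality gives `∑ₗ (∑ⱼ xₗⱼ)² ≥ ‖∑ⱼ ψⱼ‖²`, so it is enough to bound, for
a single vector `x ≥ 0` and a suitable `c ≥ 0`, the Lagrangian of the negative entropy with the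
overlap `(∑ⱼ xⱼ)² / ∑ⱼ xⱼ²`.

Given `∑ xⱼ` and `∑ xⱼ²`, the negative entropy is largest at a vector `(a, b, …, b)` with `b ≤ a`:
the quadratic that touches `y² log y²` at `b` and meets it at `a` lies above it on `[0, a]`,
because the derivative of `y² log y²` is convex. With `n = m - 1` and `w = b / a` this leaves a
function of `w ∈ [0, 1]`. The multiplier for which a given `w₀ ≤ 1 / n` is critical increases with
`w₀`, and at `w₀ = 1 / n` the Lagrangian takes the same value as at `w = 1`; hence `w₀` is a global
maximum. In the coordinates `n = e^{2N}`, `w = e^{-2s}` the monotonicity is that of `sinh s / s`.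

The vectors `ẽₖ` have nonnegative scalar products with the edges, and these form a constant vector
for `k = 0` and, up to a permutation, a vector `(a, b, …, b)` for `k ≥ 1`. The parameter `t` makes
`b / a` equal to `1 / n`, unless this would need `t > 1`; then `t = 1`, and `b / a ≤ 1 / n` is
dictated by the overlap `m r₀`. So all the inequalities become equalities.
-/

section EqualVariables

open Set

theorem nonpos_of_convexOn_deriv {g g' : ℝ → ℝ} {l b a : ℝ} (hlb : l < b) (hba : b < a)
    (hcont : ContinuousOn g (Icc l a)) (hderiv : ∀ x ∈ Ioo l a, HasDerivAt g (g' x) x)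
    (hconv : ConvexOn ℝ (Ioo l a) g') (hb : g b = 0) (hb' : g' b = 0) (ha : g a = 0)
    {x : ℝ} (hx : x ∈ Icc l a) : g x ≤ 0 := by
  obtain ⟨ξ, ⟨hbξ, hξa⟩, hξ⟩ : ∃ ξ ∈ Ioo b a, g' ξ = 0 :=
    exists_hasDerivAt_eq_zero hba (hcont.mono (Icc_subset_Icc_left hlb.le)) (hb.trans ha.symm)
      fun y hy => hderiv y ⟨hlb.trans hy.1, hy.2⟩
  have hbm : b ∈ Ioo l a := ⟨hlb, hba⟩
  have hξm : ξ ∈ Ioo l a := ⟨hlb.trans hbξ, hξa⟩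
  have mono {u v : ℝ} (hu : l ≤ u) (hv : v ≤ a) (h : ∀ y ∈ Ioo u v, 0 ≤ g' y) :
      MonotoneOn g (Icc u v) := by
    refine monotoneOn_of_hasDerivWithinAt_nonneg (convex_Icc u v)
      (hcont.mono (Icc_subset_Icc hu hv)) (f' := g') (fun y hy => ?_) ?_ <;> rw [interior_Icc] at *
    · exact (hderiv y ⟨hu.trans_lt hy.1, hy.2.trans_le hv⟩).hasDerivWithinAt
    · exact h
  rcases le_total x b with hxb | hbx
  · refine hb ▸ mono le_rfl hba.le (fun y hy => ?_) ⟨hx.1, hxb⟩ (right_mem_Icc.2 hlb.le) hxb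
    exact hb'.ge.trans <| hconv.le_left_of_right_le'' ⟨hy.1, hy.2.trans hba⟩ hξm hy.2.le hbξ
      (hξ.trans hb'.symm).le
  rcases le_total x ξ with hxξ | hξx
  · refine hb ▸ antitoneOn_of_hasDerivWithinAt_nonpos (convex_Icc b ξ)
      (hcont.mono (Icc_subset_Icc hlb.le hξa.le)) (f' := g') (fun y hy => ?_) (fun y hy => ?_)
      (left_mem_Icc.2 hbξ.le) ⟨hbx, hxξ⟩ hbx <;> rw [interior_Icc] at *
    · exact (hderiv y ⟨hlb.trans hy.1, hy.2.trans hξa⟩).hasDerivWithinAt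
    · simpa [hb', hξ] using hconv.le_max_of_mem_Icc hbm hξm (Ioo_subset_Icc_self hy)
  · refine ha ▸ mono hξm.1.le le_rfl (fun y hy => ?_) ⟨hξx, hx.2⟩ (right_mem_Icc.2 hξa.le) hx.2
    exact hξ.ge.trans <| hconv.le_right_of_left_le'' hbm ⟨hξm.1.trans hy.1, hy.2⟩ hbξ hy.1.le
      (hb'.trans hξ.symm).le

theorem exists_le_add_sq_of_convexOn_deriv {f f' : ℝ → ℝ} {l b a : ℝ} (hlb : l < b) (hba : b < a)
    (hcont : ContinuousOn f (Icc l a)) (hderiv : ∀ x ∈ Ioo l a, HasDerivAt f (f' x) x)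
    (hconv : ConvexOn ℝ (Ioo l a) f') :
    ∃ κ : ℝ, (∀ x ∈ Icc l a, f x ≤ f b + f' b * (x - b) + κ * (x - b) ^ 2) ∧
      f b + f' b * (a - b) + κ * (a - b) ^ 2 = f a := by
  obtain ⟨κ, hκ⟩ : ∃ κ : ℝ, f b + f' b * (a - b) + κ * (a - b) ^ 2 = f a := by
    have : a - b ≠ 0 := (sub_pos.2 hba).ne'
    exact ⟨(f a - f b - f' b * (a - b)) / (a - b) ^ 2, by field_simp; ring⟩
  refine ⟨κ, fun x hx => ?_, hκ⟩
  let g : ℝ → ℝ := fun x => f x - (f b + f' b * (x - b) + κ * (x - b) ^ 2)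
  let g' : ℝ → ℝ := fun x => f' x - (f' b + 2 * κ * (x - b))
  have hline (y : ℝ) : HasDerivAt (fun x => x - b) 1 y := (hasDerivAt_id y).sub_const b
  refine sub_nonpos.1 (nonpos_of_convexOn_deriv (g := g) (g' := g') hlb hba
    (hcont.sub (by fun_prop)) (fun y hy => ?_) ?_ (by simp [g]) (by simp [g'])
    (by simp [g, hκ]) hx)
  · refine ((hderiv y hy).sub ((((hline y).const_mul (f' b)).const_add (f b)).add
      (((hline y).pow 2).const_mul κ))).congr_deriv ?_
    simp only [g']; ring
  · have h : ConcaveOn ℝ (Ioo l a) fun x => f' b + 2 * κ * (x - b) :=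
      ⟨convex_Ioo l a, fun x _ y _ s t _ _ hst => le_of_eq (by
        simp only [smul_eq_mul]; linear_combination (f' b - 2 * κ * b) * hst)⟩
    exact hconv.sub h

variable {ι : Type*} [Fintype ι] {n : ℝ} {x : ι → ℝ} {a b : ℝ}

theorem le_of_sum_eq_of_sum_sq_eq (hn : 0 < n) (hcard : Fintype.card ι = n + 1) (hab : b ≤ a)
    (hsum : ∑ j, x j = a + n * b) (hsq : ∑ j, x j ^ 2 = a ^ 2 + n * b ^ 2) (j : ι) :
    x j ≤ a := by
  classical
  have hcs := sq_sum_le_card_mul_sum_sq (s := Finset.univ.erase j) (f := x)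
  have hcard' : ((Finset.univ.erase j).card : ℝ) = n := by
    rw [Finset.card_erase_of_mem (Finset.mem_univ j), Finset.card_univ,
      Nat.cast_pred (Fintype.card_pos_iff.2 ⟨j⟩), hcard, add_sub_cancel_right]
  have hsum' := Finset.add_sum_erase Finset.univ x (Finset.mem_univ j)
  have hsq' := Finset.add_sum_erase Finset.univ (fun i => x i ^ 2) (Finset.mem_univ j)
  rw [hcard', eq_sub_of_add_eq' hsum', eq_sub_of_add_eq' hsq', hsum, hsq] at hcs
  by_contra! h
  have : 0 < (x j - a) * ((n + 1) * (x j - a) + 2 * n * (a - b)) := by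
    have := sub_pos.2 h
    have := sub_nonneg.2 hab
    positivity
  nlinarith

/-- Tangency at `b` and interpolation at `a` make the bound exact at the extremal vector. -/
theorem sum_le_of_convexOn_deriv {f f' : ℝ → ℝ} (hn : 0 < n) (hcard : Fintype.card ι = n + 1)
    (hcont : ContinuousOn f (Ici 0)) (hderiv : ∀ y, 0 < y → HasDerivAt f (f' y) y)
    (hconv : ConvexOn ℝ (Ioi 0) f') (hx : ∀ j, 0 ≤ x j) (hb : 0 ≤ b) (hab : b ≤ a)
    (hsum : ∑ j, x j = a + n * b) (hsq : ∑ j, x j ^ 2 = a ^ 2 + n * b ^ 2) :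
    ∑ j, f (x j) ≤ f a + n * f b := by
  have hxa := le_of_sum_eq_of_sum_sq_eq hn hcard hab hsum hsq
  have hquad (A B C : ℝ) : ∑ j, (A + B * (x j - b) + C * (x j - b) ^ 2) =
      (n + 1) * A + B * (a - b) + C * (a - b) ^ 2 := by
    have (j : ι) : A + B * (x j - b) + C * (x j - b) ^ 2 =
      (A - B * b + C * b ^ 2) + (B - 2 * C * b) * x j + C * x j ^ 2 := by ring
    simp only [this, Finset.sum_add_distrib, ← Finset.mul_sum, hsum, hsq, Finset.sum_const,
      Finset.card_univ, nsmul_eq_mul, hcard]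
    ring
  suffices h : ∃ κ f'b : ℝ, (∀ j, f (x j) ≤ f b + f'b * (x j - b) + κ * (x j - b) ^ 2) ∧
      f b + f'b * (a - b) + κ * (a - b) ^ 2 = f a by
    obtain ⟨κ, f'b, hle, heq⟩ := h
    calc ∑ j, f (x j) ≤ ∑ j, (f b + f'b * (x j - b) + κ * (x j - b) ^ 2) :=
          Finset.sum_le_sum fun j _ => hle j
      _ = f a + n * f b := by rw [hquad, ← heq]; ring
  rcases hab.eq_or_lt with rfl | hab
  · have h0 : ∑ j, (x j - b) ^ 2 = 0 := by simpa using hquad 0 0 1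
    have hxb (j : ι) : x j - b = 0 := by
      simpa using
        (Finset.sum_eq_zero_iff_of_nonneg fun j _ => sq_nonneg _).1 h0 j (Finset.mem_univ j)
    exact ⟨0, 0, fun j => by simp [sub_eq_zero.1 (hxb j)], by simp⟩
  rcases hb.eq_or_lt with rfl | hb
  · have h0 : ∑ j, x j * (a - x j) = 0 := by
      simp only [mul_sub, Finset.sum_sub_distrib, ← Finset.sum_mul, hsum, ← sq, hsq]
      ring
    have hxj (j : ι) : x j = 0 ∨ x j = a := by
      have := (Finset.sum_eq_zero_iff_of_nonneg fun j _ =>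
        mul_nonneg (hx j) (sub_nonneg.2 (hxa j))).1 h0 j (Finset.mem_univ j)
      simpa [sub_eq_zero, eq_comm] using this
    refine ⟨0, (f a - f 0) / a, fun j => ?_, ?_⟩
    · rcases hxj j with h | h <;> simp [h, hab.ne']
    · simp [hab.ne']
  · obtain ⟨κ, hle, heq⟩ := exists_le_add_sq_of_convexOn_deriv hb hab
      (hcont.mono Icc_subset_Ici_self) (fun y hy => hderiv y hy.1)
      (hconv.subset Ioo_subset_Ioi_self (convex_Ioo 0 a))
    exact ⟨κ, f' b, fun j => hle (x j) ⟨hx j, hxa j⟩, heq⟩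

theorem exists_sum_eq_and_sum_sq_eq (hn : 0 < n) (hcard : Fintype.card ι = n + 1)
    (hx : ∀ j, 0 ≤ x j) :
    ∃ a b : ℝ, 0 ≤ b ∧ b ≤ a ∧ ∑ j, x j = a + n * b ∧ ∑ j, x j ^ 2 = a ^ 2 + n * b ^ 2 := by
  have hcs := sq_sum_le_card_mul_sum_sq (s := Finset.univ) (f := x)
  have hcs' := Finset.sum_sq_le_sq_sum_of_nonneg (s := Finset.univ) fun j _ => hx j
  have hS := Finset.sum_nonneg (s := Finset.univ) fun j _ => hx j
  rw [Finset.card_univ, hcard] at hcs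
  generalize ∑ j, x j = S at *
  generalize ∑ j, x j ^ 2 = Q at *
  obtain ⟨δ, hδ, hδ2⟩ : ∃ δ : ℝ, 0 ≤ δ ∧ n * δ ^ 2 = (n + 1) * Q - S ^ 2 := by
    refine ⟨√(((n + 1) * Q - S ^ 2) / n), Real.sqrt_nonneg _, ?_⟩
    rw [Real.sq_sqrt (div_nonneg (sub_nonneg.2 hcs) hn.le), mul_div_cancel₀ _ hn.ne']
  have hδS : δ ≤ S := by
    refine le_of_sq_le_sq ?_ hS
    nlinarith
  have hb : 0 ≤ (S - δ) / (n + 1) := div_nonneg (sub_nonneg.2 hδS) (by positivity)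
  refine ⟨(S - δ) / (n + 1) + δ, (S - δ) / (n + 1), hb, by linarith, by field_simp; ring, ?_⟩
  field_simp
  linear_combination (-(n + 1)) * hδ2

end EqualVariables

section TwoLevel

open Set

/-- The negative Shannon entropy, in nats, of the probability distribution proportional to
`(1, w², …, w²)` with `n` entries `w²`, for a real `n`. -/
noncomputable def twoLevelNegEntropy (n w : ℝ) : ℝ :=
  -Real.log (1 + n * w ^ 2) + 2 * n * w * (w * Real.log w) / (1 + n * w ^ 2)

/-- The ratio `(∑ xⱼ)² / ∑ xⱼ²` for the vector `x = (1, w, …, w)` with `n` entries `w`, for a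
real `n`. -/
noncomputable def twoLevelOverlap (n w : ℝ) : ℝ := (1 + n * w) ^ 2 / (1 + n * w ^ 2)

/-- The Lagrange function for maximizing the negative entropy at a given overlap. -/
noncomputable def twoLevelLagrangian (n c w : ℝ) : ℝ :=
  twoLevelNegEntropy n w + c * twoLevelOverlap n w

/-- The multiplier `c` for which `w` is a critical point of `twoLevelLagrangian n c`, with value
`0` at the junk point `w = 1`, where every multiplier is critical. -/
noncomputable def twoLevelMultiplier (n w : ℝ) : ℝ :=
  -2 * (w * Real.log w) / ((1 - w) * (1 + n * w))

theorem convexOn_sinh : ConvexOn ℝ (Ici 0) Real.sinh := by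
  refine MonotoneOn.convexOn_of_deriv (convex_Ici 0) Real.continuous_sinh.continuousOn
    Real.differentiable_sinh.differentiableOn ?_
  rw [interior_Ici, Real.deriv_sinh]
  intro x (hx : 0 < x) y (hy : 0 < y) hxy
  rwa [Real.cosh_le_cosh, abs_of_pos hx, abs_of_pos hy]

theorem mul_sinh_le_mul_sinh {s u : ℝ} (hs : 0 ≤ s) (hsu : s ≤ u) :
    u * Real.sinh s ≤ s * Real.sinh u := by
  rcases (hs.trans hsu).eq_or_lt with rfl | hu
  · simp [hsu.antisymm hs]
  have h := convexOn_sinh.2 (mem_Ici.2 le_rfl) (mem_Ici.2 hu.le)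
    (sub_nonneg.2 ((div_le_one hu).2 hsu)) (div_nonneg hs hu.le) (sub_add_cancel 1 (s / u))
  simp only [smul_eq_mul, Real.sinh_zero, mul_zero, zero_add, div_mul_cancel₀ _ hu.ne'] at h
  rwa [div_mul_eq_mul_div, le_div_iff₀ hu, mul_comm] at h

theorem twoLevelMultiplier_exp (N s : ℝ) :
    twoLevelMultiplier (Real.exp (2 * N)) (Real.exp (-2 * s)) =
      s / (Real.exp N * (Real.sinh s * Real.cosh (s - N))) := by
  have h : (1 - Real.exp (-2 * s)) * (1 + Real.exp (2 * N) * Real.exp (-2 * s)) =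
      4 * Real.exp (-2 * s) * (Real.exp N * (Real.sinh s * Real.cosh (s - N))) := by
    simp only [Real.sinh_eq, Real.cosh_eq, sub_eq_add_neg, neg_add, neg_neg, Real.exp_add,
      show -2 * s = -s + -s by ring, two_mul, Real.exp_neg]
    field_simp
    ring
  rw [twoLevelMultiplier, h, Real.log_exp,
    show -2 * (Real.exp (-2 * s) * (-2 * s)) = 4 * Real.exp (-2 * s) * s by ring,
    mul_div_mul_left _ _ (by positivity)]

variable {n w x y a b c : ℝ}

theorem exists_exp_two_mul_eq (hx : 0 < x) : ∃ s, Real.exp (2 * s) = x :=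
  ⟨Real.log x / 2, by rw [mul_div_cancel₀ _ two_ne_zero, Real.exp_log hx]⟩

theorem exists_exp_neg_two_mul_eq (hx : 0 < x) : ∃ s, Real.exp (-2 * s) = x := by
  obtain ⟨s, hs⟩ := exists_exp_two_mul_eq hx
  exact ⟨-s, by rwa [neg_mul_neg]⟩

theorem twoLevelMultiplier_nonneg (hn : 0 ≤ n) (hw : 0 ≤ w) (hw1 : w ≤ 1) :
    0 ≤ twoLevelMultiplier n w :=
  div_nonneg (mul_nonneg_of_nonpos_of_nonpos (by norm_num) (Real.mul_log_nonpos hw hw1))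
    (mul_nonneg (sub_nonneg.2 hw1) (by positivity))

theorem twoLevelMultiplier_le_of_le (hn : 0 < n) (hx : 0 ≤ x) (hxy : x ≤ y) (hy : y < 1)
    (hny : n * y ≤ 1) : twoLevelMultiplier n x ≤ twoLevelMultiplier n y := by
  rcases hx.eq_or_lt with rfl | hx
  · simpa [twoLevelMultiplier] using twoLevelMultiplier_nonneg hn.le hxy hy.le
  obtain ⟨N, rfl⟩ := exists_exp_two_mul_eq hn
  obtain ⟨s, rfl⟩ := exists_exp_neg_two_mul_eq hx
  obtain ⟨u, rfl⟩ := exists_exp_neg_two_mul_eq (hx.trans_le hxy)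
  rw [← Real.exp_add, Real.exp_le_one_iff] at hny
  rw [Real.exp_le_exp] at hxy
  rw [Real.exp_lt_one_iff] at hy
  have hu : 0 < u := by linarith
  have hus : u ≤ s := by linarith
  have hcosh : Real.cosh (u - N) ≤ Real.cosh (s - N) := by
    rw [Real.cosh_le_cosh, abs_of_nonneg (by linarith), abs_of_nonneg (by linarith)]
    linarith
  have := Real.sinh_pos_iff.2 hu
  have := Real.sinh_pos_iff.2 (hu.trans_le hus)
  rw [twoLevelMultiplier_exp, twoLevelMultiplier_exp,
    div_le_div_iff₀ (by positivity) (by positivity)]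
  calc s * (Real.exp N * (Real.sinh u * Real.cosh (u - N)))
      = Real.exp N * (s * Real.sinh u * Real.cosh (u - N)) := by ring
    _ ≤ Real.exp N * (u * Real.sinh s * Real.cosh (s - N)) := by
        gcongr ?_ * (?_ * ?_)
        exact mul_sinh_le_mul_sinh hu.le hus
    _ = u * (Real.exp N * (Real.sinh s * Real.cosh (s - N))) := by ring

theorem twoLevelMultiplier_inv (hn : n ≠ 0) : twoLevelMultiplier n n⁻¹ = Real.log n / (n - 1) := by
  rw [twoLevelMultiplier, Real.log_inv, mul_inv_cancel₀ hn,
    show -2 * (n⁻¹ * -Real.log n) = 2 * n⁻¹ * Real.log n by ring,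
    show (1 - n⁻¹) * (1 + 1) = 2 * n⁻¹ * (n - 1) by field_simp; ring,
    mul_div_mul_left _ _ (by positivity)]

theorem two_mul_sinh_mul_cosh_sub (s N : ℝ) :
    2 * (Real.sinh s * Real.cosh (s - N)) = Real.sinh (2 * s - N) + Real.sinh N := by
  have hadd := Real.sinh_add s (s - N)
  have hsub := Real.sinh_sub s (s - N)
  rw [show s + (s - N) = 2 * s - N by ring] at hadd
  rw [sub_sub_cancel] at hsub
  rw [hadd, hsub]
  ring

theorem twoLevelMultiplier_exp_inv (N : ℝ) :
    twoLevelMultiplier (Real.exp (2 * N)) (Real.exp (2 * N))⁻¹ =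
      N / (Real.exp N * Real.sinh N) := by
  rw [← Real.exp_neg, ← neg_mul, twoLevelMultiplier_exp, sub_self, Real.cosh_zero, mul_one]

theorem twoLevelMultiplier_inv_le (hn : 0 < n) (hnw : n⁻¹ ≤ w) (hw : w < 1) (hnw2 : n * w ^ 2 ≤ 1) :
    twoLevelMultiplier n n⁻¹ ≤ twoLevelMultiplier n w := by
  obtain ⟨N, rfl⟩ := exists_exp_two_mul_eq hn
  obtain ⟨s, rfl⟩ := exists_exp_neg_two_mul_eq ((inv_pos.2 hn).trans_le hnw)
  rw [← Real.exp_nat_mul, ← Real.exp_add, Real.exp_le_one_iff] at hnw2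
  rw [← Real.exp_neg, Real.exp_le_exp] at hnw
  rw [Real.exp_lt_one_iff] at hw
  push_cast at hnw2
  have hsinh_N := Real.sinh_pos_iff.2 (show 0 < N by linarith)
  have hsinh_s := Real.sinh_pos_iff.2 (show 0 < s by linarith)
  have h := mul_sinh_le_mul_sinh (show 0 ≤ 2 * s - N by linarith) (show 2 * s - N ≤ N by linarith)
  rw [twoLevelMultiplier_exp_inv, twoLevelMultiplier_exp,
    div_le_div_iff₀ (by positivity) (by positivity)]
  have := two_mul_sinh_mul_cosh_sub s N
  have key : N * (Real.sinh s * Real.cosh (s - N)) ≤ s * Real.sinh N := by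
    nlinarith
  have := mul_le_mul_of_nonneg_left key (Real.exp_pos N).le
  linarith

theorem le_twoLevelMultiplier_inv (hw : 0 < w) (hw1 : w < 1) (hnw2 : 1 ≤ n * w ^ 2) :
    twoLevelMultiplier n w ≤ twoLevelMultiplier n n⁻¹ := by
  obtain ⟨N, rfl⟩ := exists_exp_two_mul_eq
    (pos_of_mul_pos_left (zero_lt_one.trans_le hnw2) (sq_nonneg w))
  obtain ⟨s, rfl⟩ := exists_exp_neg_two_mul_eq hw
  rw [← Real.exp_nat_mul, ← Real.exp_add, Real.one_le_exp_iff] at hnw2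
  rw [Real.exp_lt_one_iff] at hw1
  push_cast at hnw2
  have hsinh_N := Real.sinh_pos_iff.2 (show 0 < N by linarith)
  have hsinh_s := Real.sinh_pos_iff.2 (show 0 < s by linarith)
  have h := mul_sinh_le_mul_sinh (show 0 ≤ N - 2 * s by linarith) (show N - 2 * s ≤ N by linarith)
  rw [twoLevelMultiplier_exp_inv, twoLevelMultiplier_exp,
    div_le_div_iff₀ (by positivity) (by positivity)]
  have hadd := two_mul_sinh_mul_cosh_sub s N
  rw [← neg_sub N (2 * s), Real.sinh_neg] at hadd
  have key : s * Real.sinh N ≤ N * (Real.sinh s * Real.cosh (s - N)) := by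
    nlinarith
  have := mul_le_mul_of_nonneg_left key (Real.exp_pos N).le
  linarith

theorem twoLevelMultiplier_one_le_one (hw : 0 < w) (hw1 : w < 1) : twoLevelMultiplier 1 w ≤ 1 := by
  obtain ⟨s, rfl⟩ := exists_exp_neg_two_mul_eq hw
  rw [Real.exp_lt_one_iff] at hw1
  have hs : 0 < s := by linarith
  have hsinh := Real.sinh_pos_iff.2 hs
  have h := twoLevelMultiplier_exp 0 s
  rw [mul_zero, Real.exp_zero, one_mul, sub_zero] at h
  rw [h, div_le_one (by positivity)]
  exact (Real.self_le_sinh_iff.2 hs.le).trans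
    (le_mul_of_one_le_right hsinh.le (Real.one_le_cosh s))

theorem continuous_twoLevelLagrangian (hn : 0 ≤ n) (c : ℝ) :
    Continuous (twoLevelLagrangian n c) := by
  unfold twoLevelLagrangian twoLevelNegEntropy twoLevelOverlap
  have h (w : ℝ) : 1 + n * w ^ 2 ≠ 0 := by positivity
  have hl := Real.continuous_mul_log
  refine ((Continuous.log (by fun_prop) h).neg.add ?_).add
    (continuous_const.mul (Continuous.div (by fun_prop) (by fun_prop) h))
  exact ((by fun_prop : Continuous fun w : ℝ => 2 * n * w).mul hl).div (by fun_prop) h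

theorem hasDerivAt_twoLevelLagrangian (hn : 0 ≤ n) (c : ℝ) (hw : 0 < w) (hw1 : w < 1) :
    HasDerivAt (twoLevelLagrangian n c)
      (2 * n * ((1 - w) * (1 + n * w)) / (1 + n * w ^ 2) ^ 2 * (c - twoLevelMultiplier n w)) w := by
  have h : 1 + n * w ^ 2 ≠ 0 := by positivity
  have hq : HasDerivAt (fun w : ℝ => 1 + n * w ^ 2) (n * (2 * w)) w := by
    simpa using ((hasDerivAt_pow 2 w).const_mul n).const_add 1
  have hl : HasDerivAt (fun w : ℝ => 2 * n * w * (w * Real.log w))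
      (2 * n * (w * Real.log w) + 2 * n * w * (Real.log w + 1)) w :=
    (((hasDerivAt_id w).const_mul (2 * n)).mul (Real.hasDerivAt_mul_log hw.ne')).congr_deriv
      (by simp)
  have hs : HasDerivAt (fun w : ℝ => (1 + n * w) ^ 2) (2 * (1 + n * w) * n) w :=
    ((((hasDerivAt_id w).const_mul n).const_add 1).pow 2).congr_deriv (by simp)
  refine (((hq.log h).neg.add (hl.div hq h)).add ((hs.div hq h).const_mul c)).congr_deriv ?_
  have hc : (1 - w) * (1 + n * w) * (c - twoLevelMultiplier n w) =
      c * ((1 - w) * (1 + n * w)) + 2 * (w * Real.log w) := by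
    have : (1 - w) * (1 + n * w) ≠ 0 := mul_ne_zero (sub_ne_zero.2 hw1.ne') (by positivity)
    rw [mul_sub, twoLevelMultiplier, mul_div_cancel₀ _ this]; ring
  calc _ = 2 * n * (c * ((1 - w) * (1 + n * w)) + 2 * (w * Real.log w)) / (1 + n * w ^ 2) ^ 2 := by
        field_simp; ring
    _ = _ := by rw [← hc]; ring

theorem monotoneOn_twoLevelLagrangian (hn : 0 ≤ n) (ha : 0 ≤ a) (hb : b ≤ 1)
    (h : ∀ w ∈ Ioo a b, twoLevelMultiplier n w ≤ c) :
    MonotoneOn (twoLevelLagrangian n c) (Icc a b) := by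
  refine monotoneOn_of_hasDerivWithinAt_nonneg (convex_Icc a b)
    (continuous_twoLevelLagrangian hn c).continuousOn (fun w hw => (hasDerivAt_twoLevelLagrangian hn
      c ?_ ?_).hasDerivWithinAt) (fun w hw => ?_) <;> rw [interior_Icc] at hw
  · exact ha.trans_lt hw.1
  · exact hw.2.trans_le hb
  · have : 0 ≤ w := ha.trans hw.1.le
    have := sub_nonneg.2 (hw.2.le.trans hb)
    have := sub_nonneg.2 (h w hw)
    positivity

theorem antitoneOn_twoLevelLagrangian (hn : 0 ≤ n) (ha : 0 ≤ a) (hb : b ≤ 1)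
    (h : ∀ w ∈ Ioo a b, c ≤ twoLevelMultiplier n w) :
    AntitoneOn (twoLevelLagrangian n c) (Icc a b) := by
  refine antitoneOn_of_hasDerivWithinAt_nonpos (convex_Icc a b)
    (continuous_twoLevelLagrangian hn c).continuousOn (fun w hw => (hasDerivAt_twoLevelLagrangian hn
      c ?_ ?_).hasDerivWithinAt) (fun w hw => ?_) <;> rw [interior_Icc] at hw
  · exact ha.trans_lt hw.1
  · exact hw.2.trans_le hb
  · have : 0 ≤ w := ha.trans hw.1.le
    have := sub_nonneg.2 (hw.2.le.trans hb)
    exact mul_nonpos_of_nonneg_of_nonpos (by positivity) (sub_nonpos.2 (h w hw))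

theorem twoLevelOverlap_le_of_le (hn : 0 ≤ n) (hx : 0 ≤ x) (hxy : x ≤ y) (hy : y ≤ 1) :
    twoLevelOverlap n x ≤ twoLevelOverlap n y := by
  have h : 0 ≤ n * (y - x) * ((2 - x - y) + n * (x * (1 - y) + y * (1 - x))) := by
    have : 0 ≤ y := hx.trans hxy
    have := sub_nonneg.2 hxy
    have := sub_nonneg.2 hy
    have := sub_nonneg.2 (hxy.trans hy)
    have : 0 ≤ 2 - x - y := by linarith
    positivity
  rw [twoLevelOverlap, twoLevelOverlap, div_le_div_iff₀ (by positivity) (by positivity)]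
  linarith

theorem twoLevelOverlap_inv (hn : 0 < n) : twoLevelOverlap n n⁻¹ = 4 * n / (1 + n) := by
  have : (0 : ℝ) < 1 + n := by positivity
  rw [twoLevelOverlap, mul_inv_cancel₀ hn.ne']
  field_simp
  ring

theorem twoLevelNegEntropy_inv (hn : 0 < n) :
    twoLevelNegEntropy n n⁻¹ = (n - 1) / (1 + n) * Real.log n - Real.log (1 + n) := by
  have h : (0 : ℝ) < 1 + n := by positivity
  rw [twoLevelNegEntropy, show 1 + n * n⁻¹ ^ 2 = (1 + n) / n by field_simp; ring,
    Real.log_div h.ne' hn.ne', Real.log_inv]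
  field_simp
  ring

theorem twoLevelLagrangian_inv_one_eq (hn : 1 < n) :
    twoLevelLagrangian n (twoLevelMultiplier n n⁻¹) 1 =
      twoLevelLagrangian n (twoLevelMultiplier n n⁻¹) n⁻¹ := by
  have hn0 : 0 < n := zero_lt_one.trans hn
  have h1 : n - 1 ≠ 0 := (sub_pos.2 hn).ne'
  rw [twoLevelLagrangian, twoLevelLagrangian, twoLevelNegEntropy_inv hn0, twoLevelOverlap_inv hn0,
    twoLevelMultiplier_inv hn0.ne', twoLevelNegEntropy, twoLevelOverlap, Real.log_one]
  simp only [one_pow, mul_one]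
  field_simp
  ring

/-- Past `n⁻¹` the Lagrangian first decreases and then climbs back to its value at `n⁻¹`. -/
theorem twoLevelLagrangian_le_inv (hn : 1 < n) (hw : n⁻¹ ≤ w) (hw1 : w ≤ 1) :
    twoLevelLagrangian n (twoLevelMultiplier n n⁻¹) w ≤
      twoLevelLagrangian n (twoLevelMultiplier n n⁻¹) n⁻¹ := by
  have hn0 : 0 < n := zero_lt_one.trans hn
  have hw0 : 0 < w := (inv_pos.2 hn0).trans_le hw
  rcases le_total (n * w ^ 2) 1 with h | h
  · refine antitoneOn_twoLevelLagrangian hn0.le (inv_nonneg.2 hn0.le) hw1 (fun v hv => ?_)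
      (left_mem_Icc.2 hw) (right_mem_Icc.2 hw) hw
    refine twoLevelMultiplier_inv_le hn0 hv.1.le (hv.2.trans_le hw1) (le_trans ?_ h)
    have := (inv_pos.2 hn0).trans hv.1
    have := hv.2.le
    gcongr
  · rw [← twoLevelLagrangian_inv_one_eq hn]
    refine monotoneOn_twoLevelLagrangian hn0.le hw0.le le_rfl (fun v hv => ?_)
      (left_mem_Icc.2 hw1) (right_mem_Icc.2 hw1) hw1
    refine le_twoLevelMultiplier_inv (hw0.trans hv.1) hv.2 (h.trans ?_)
    have := hv.1.le
    gcongr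

theorem twoLevelLagrangian_le {w₀ : ℝ} (hn : 1 ≤ n) (hw₀ : 0 ≤ w₀) (hw₀1 : w₀ < 1)
    (hnw₀ : n * w₀ ≤ 1) (hw : w ∈ Icc 0 1) :
    twoLevelLagrangian n (twoLevelMultiplier n w₀) w ≤
      twoLevelLagrangian n (twoLevelMultiplier n w₀) w₀ := by
  have hn0 : 0 < n := zero_lt_one.trans_le hn
  have hinv : n⁻¹ ≤ 1 := inv_le_one_of_one_le₀ hn
  have mul_le {v : ℝ} (hv : v ≤ n⁻¹) : n * v ≤ 1 := by rwa [mul_comm, ← le_div_iff₀ hn0, one_div]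
  have hw₀n : w₀ ≤ n⁻¹ := by rwa [← one_div, le_div_iff₀ hn0, mul_comm]
  have hmid {v : ℝ} (hv : w₀ ≤ v) (hvn : v ≤ n⁻¹) :
      twoLevelLagrangian n (twoLevelMultiplier n w₀) v ≤
        twoLevelLagrangian n (twoLevelMultiplier n w₀) w₀ :=
    antitoneOn_twoLevelLagrangian hn0.le hw₀ hinv
      (fun u hu => twoLevelMultiplier_le_of_le hn0 hw₀ hu.1.le (hu.2.trans_le hinv)
        (mul_le hu.2.le)) (left_mem_Icc.2 hw₀n) ⟨hv, hvn⟩ hv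
  rcases le_total w w₀ with h | h
  · exact monotoneOn_twoLevelLagrangian hn0.le le_rfl hw₀1.le
      (fun v hv => twoLevelMultiplier_le_of_le hn0 hv.1.le hv.2.le hw₀1 hnw₀)
      ⟨hw.1, h⟩ (right_mem_Icc.2 hw₀) h
  rcases le_total w n⁻¹ with h' | h'
  · exact hmid h h'
  rcases hn.eq_or_lt with rfl | hn1
  · exact hmid h (by simpa using hw.2)
  have hcoef : twoLevelMultiplier n w₀ ≤ twoLevelMultiplier n n⁻¹ :=
    twoLevelMultiplier_le_of_le hn0 hw₀ hw₀n (inv_lt_one_of_one_lt₀ hn1) (mul_le le_rfl)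
  have hover : twoLevelOverlap n n⁻¹ ≤ twoLevelOverlap n w :=
    twoLevelOverlap_le_of_le hn0.le (inv_nonneg.2 hn0.le) h' hw.2
  refine le_trans ?_ (hmid hw₀n le_rfl)
  have hright := twoLevelLagrangian_le_inv hn1 h' hw.2
  have := mul_le_mul_of_nonneg_left hover (sub_nonneg.2 hcoef)
  simp only [twoLevelLagrangian] at hright ⊢
  linarith

theorem exists_twoLevelLagrangian_le {w₀ : ℝ} (hn : 1 ≤ n) (hw₀ : 0 ≤ w₀) (hnw₀ : n * w₀ ≤ 1) :
    ∃ c, 0 ≤ c ∧ ∀ w ∈ Icc 0 1, twoLevelLagrangian n c w ≤ twoLevelLagrangian n c w₀ := by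
  have hw₀1 : w₀ ≤ 1 := (le_mul_of_one_le_left hw₀ hn).trans hnw₀
  rcases hw₀1.lt_or_eq with h | rfl
  · exact ⟨_, twoLevelMultiplier_nonneg (zero_le_one.trans hn) hw₀ h.le,
      fun w hw => twoLevelLagrangian_le hn hw₀ h hnw₀ hw⟩
  · obtain rfl : n = 1 := le_antisymm (by simpa using hnw₀) hn
    exact ⟨1, zero_le_one, fun w hw => monotoneOn_twoLevelLagrangian zero_le_one le_rfl le_rfl
      (fun v hv => twoLevelMultiplier_one_le_one hv.1 hv.2) hw (right_mem_Icc.2 zero_le_one) hw.2⟩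

theorem mul_twoLevelOverlap (hn : 0 ≤ n) (w x : ℝ) :
    (x ^ 2 + n * (w * x) ^ 2) * twoLevelOverlap n w = (x + n * (w * x)) ^ 2 := by
  have : 1 + n * w ^ 2 ≠ 0 := by positivity
  rw [twoLevelOverlap]
  field_simp

theorem mul_twoLevelNegEntropy (hn : 0 ≤ n) (w x : ℝ) :
    (x ^ 2 + n * (w * x) ^ 2) * twoLevelNegEntropy n w =
      x ^ 2 * Real.log (x ^ 2) + n * ((w * x) ^ 2 * Real.log ((w * x) ^ 2)) -
        (x ^ 2 + n * (w * x) ^ 2) * Real.log (x ^ 2 + n * (w * x) ^ 2) := by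
  have hq : 1 + n * w ^ 2 ≠ 0 := by positivity
  rcases eq_or_ne x 0 with rfl | hx
  · simp
  rw [show x ^ 2 + n * (w * x) ^ 2 = x ^ 2 * (1 + n * w ^ 2) by ring,
    Real.log_mul (pow_ne_zero 2 hx) hq, twoLevelNegEntropy]
  rcases eq_or_ne w 0 with rfl | hw
  · simp
  rw [mul_pow, Real.log_mul (pow_ne_zero 2 hw) (pow_ne_zero 2 hx), Real.log_pow, Real.log_pow]
  push_cast
  field_simp
  ring

end TwoLevel

section AmplitudeNegEntropy

open Set

variable {ι : Type*} [Fintype ι]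

/-- The negative Shannon entropy, in nats, of the distribution proportional to `xⱼ²`, multiplied
by `∑ xⱼ²`, so that it extends to `x = 0`. -/
noncomputable def amplitudeNegEntropy (x : ι → ℝ) : ℝ :=
  ∑ j, x j ^ 2 * Real.log (x j ^ 2) - (∑ j, x j ^ 2) * Real.log (∑ j, x j ^ 2)

theorem sum_sq_mul_log_sq_le {n a b : ℝ} {x : ι → ℝ} (hn : 0 < n)
    (hcard : Fintype.card ι = n + 1) (hx : ∀ j, 0 ≤ x j) (hb : 0 ≤ b) (hab : b ≤ a)
    (hsum : ∑ j, x j = a + n * b) (hsq : ∑ j, x j ^ 2 = a ^ 2 + n * b ^ 2) :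
    ∑ j, x j ^ 2 * Real.log (x j ^ 2) ≤
      a ^ 2 * Real.log (a ^ 2) + n * (b ^ 2 * Real.log (b ^ 2)) := by
  refine sum_le_of_convexOn_deriv (f := fun y => y ^ 2 * Real.log (y ^ 2))
    (f' := fun y => 4 * (y * Real.log y) + 2 * y) hn hcard
    (Real.continuous_mul_log.comp (continuous_pow 2)).continuousOn (fun y hy => ?_) ?_
    hx hb hab hsum hsq
  · have hpow : HasDerivAt (fun z : ℝ => z ^ 2) (2 * y) y := by simpa using hasDerivAt_pow 2 y
    have hy2 : y ^ 2 ≠ 0 := pow_ne_zero 2 hy.ne'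
    refine (hpow.mul (hpow.log hy2)).congr_deriv ?_
    rw [mul_div_cancel₀ _ hy2, Real.log_pow]; push_cast; ring
  · have hlog := Real.convexOn_mul_log.subset Ioi_subset_Ici_self (convex_Ioi 0)
    exact (hlog.smul zero_le_four).add ((convexOn_id (convex_Ioi 0)).smul zero_le_two)

theorem amplitudeNegEntropy_add_le {n c d : ℝ} {x : ι → ℝ} (hn : 0 < n)
    (hcard : Fintype.card ι = n + 1) (hx : ∀ j, 0 ≤ x j)
    (h : ∀ w ∈ Icc 0 1, twoLevelLagrangian n c w ≤ d) :
    amplitudeNegEntropy x + c * (∑ j, x j) ^ 2 ≤ d * ∑ j, x j ^ 2 := by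
  obtain ⟨a, b, hb, hab, hsum, hsq⟩ := exists_sum_eq_and_sum_sq_eq hn hcard hx
  have hentropy := sum_sq_mul_log_sq_le hn hcard hx hb hab hsum hsq
  obtain ⟨w, hw, rfl⟩ : ∃ w ∈ Icc (0 : ℝ) 1, b = w * a := by
    rcases (hb.trans hab).eq_or_lt with rfl | ha
    · exact ⟨0, left_mem_Icc.2 zero_le_one, by simp [hab.antisymm hb]⟩
    · exact ⟨b / a, ⟨div_nonneg hb ha.le, (div_le_one ha).2 hab⟩, (div_mul_cancel₀ b ha.ne').symm⟩
  rw [amplitudeNegEntropy, hsum, hsq]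
  calc _ ≤ (a ^ 2 + n * (w * a) ^ 2) * twoLevelLagrangian n c w := by
        rw [twoLevelLagrangian, mul_add, mul_twoLevelNegEntropy hn.le, mul_left_comm _ c,
          mul_twoLevelOverlap hn.le]
        gcongr
    _ ≤ d * (a ^ 2 + n * (w * a) ^ 2) := by
        rw [mul_comm]
        have := h w hw
        gcongr

theorem amplitudeNegEntropy_const (z : ℝ) :
    amplitudeNegEntropy (fun _ : ι => z) =
      -(Fintype.card ι * z ^ 2 * Real.log (Fintype.card ι)) := by
  simp only [amplitudeNegEntropy, Finset.sum_const, Finset.card_univ, nsmul_eq_mul]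
  rcases eq_or_ne z 0 with rfl | hz
  · simp
  rcases eq_or_ne (Fintype.card ι : ℝ) 0 with hι | hι
  · simp [hι]
  rw [Real.log_mul hι (pow_ne_zero 2 hz)]
  ring

variable [DecidableEq ι]

theorem sum_ite_eq_add_card_sub_one_mul (l : ι) (u v : ℝ) :
    ∑ j, (if j = l then u else v) = u + (Fintype.card ι - 1) * v := by
  have (j : ι) : (if j = l then u else v) = (if j = l then u - v else 0) + v := by
    split_ifs <;> ring
  simp only [this, Finset.sum_add_distrib, Finset.sum_ite_eq', Finset.mem_univ, if_true,
    Finset.sum_const, Finset.card_univ, nsmul_eq_mul]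
  ring

theorem amplitudeNegEntropy_twoLevel (l : ι) (w x : ℝ) :
    amplitudeNegEntropy (fun j => if j = l then x else w * x) =
      (x ^ 2 + (Fintype.card ι - 1) * (w * x) ^ 2) *
        twoLevelNegEntropy (Fintype.card ι - 1) w := by
  have hcard : (1 : ℝ) ≤ Fintype.card ι := Nat.one_le_cast.2 (Fintype.card_pos_iff.2 ⟨l⟩)
  rw [mul_twoLevelNegEntropy (sub_nonneg.2 hcard), amplitudeNegEntropy]
  simp only [apply_ite (fun y : ℝ => y ^ 2), apply_ite (fun y : ℝ => y * Real.log y),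
    sum_ite_eq_add_card_sub_one_mul]

end AmplitudeNegEntropy

section Quantum

variable {H : Type*} [NormedAddCommGroup H] [InnerProductSpace ℂ H] {m k : ℕ}

theorem inner_rankOne_self_re (φ ψ : H) {x : ℝ} (h : inner ℂ φ ψ = (x : ℂ)) :
    (inner ℂ ψ (InnerProductSpace.rankOne ℂ φ φ ψ)).re = x ^ 2 := by
  rw [InnerProductSpace.rankOne_apply, inner_smul_right, ← inner_conj_symm ψ φ, h,
    Complex.conj_ofReal, ← Complex.ofReal_mul, Complex.ofReal_re, sq]

theorem norm_sum_pyramidVector_sq (e : OrthonormalBasis (Fin m) ℂ H) (hm : 2 ≤ m) {r₀ r₁ : ℝ}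
    (hr₀ : 0 ≤ r₀) :
    ‖∑ j, pyramidVector e r₀ r₁ j‖ ^ 2 = (m : ℝ) ^ 2 * r₀ := by
  have hsum : ∑ j, pyramidVector e r₀ r₁ j = ((m * √r₀ : ℝ) : ℂ) • pyramidAxis e := by
    simp only [pyramidVector, Finset.sum_add_distrib, ← Finset.smul_sum, sum_basis e hm,
      Finset.sum_const, Finset.card_univ, Fintype.card_fin, smul_smul,
      ← Nat.cast_smul_eq_nsmul ℂ, ← add_smul]
    congr 1
    have : √((m : ℝ) * r₁) * √m + (√r₀ - √r₁) * m = m * √r₀ := by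
      rw [Real.sqrt_mul m.cast_nonneg]
      linear_combination √r₁ * Real.mul_self_sqrt m.cast_nonneg
    exact_mod_cast this
  have hax : ‖pyramidAxis e‖ ^ 2 = 1 := by
    rw [← inner_self_eq_norm_sq (𝕜 := ℂ), inner_axis_axis e hm]
    rfl
  rw [hsum, norm_smul, mul_pow, hax, Complex.norm_real, Real.norm_eq_abs, sq_abs, mul_pow,
    Real.sq_sqrt hr₀, mul_one]

theorem inner_erVector_zero_pyramidVector (e : OrthonormalBasis (Fin m) ℂ H) (hm : 2 ≤ m)
    (r₀ r₁ t : ℝ) (j : Fin m) :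
    inner ℂ (erVector e t 0) (pyramidVector e r₀ r₁ j) = ((√(1 - t ^ 2) * √r₀ : ℝ) : ℂ) := by
  simp only [erVector, Fin.cons_zero, pyramidVector, inner_add_right, inner_smul_left,
    inner_smul_right, inner_axis_basis, inner_axis_axis e hm, Complex.conj_ofReal]
  have : √((m : ℝ) * r₁) * (√(1 - t ^ 2) * (1 / √m)) + (√r₀ - √r₁) * (√(1 - t ^ 2) * 1) =
      √(1 - t ^ 2) * √r₀ := by
    rw [Real.sqrt_mul m.cast_nonneg]
    field_simp
    ring
  exact_mod_cast this

theorem inner_erVector_succ_pyramidVector (e : OrthonormalBasis (Fin m) ℂ H) (hm : 2 ≤ m)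
    (r₀ r₁ t : ℝ) (l j : Fin m) :
    inner ℂ (erVector e t l.succ) (pyramidVector e r₀ r₁ j) =
      ((if j = l then (t * √r₀ + (m - 1) * √r₁) / √m else (t * √r₀ - √r₁) / √m : ℝ) : ℂ) := by
  have hs : √(m : ℝ) ≠ 0 := by positivity
  have hsq := Real.mul_self_sqrt (Nat.cast_nonneg (α := ℝ) m)
  simp only [erVector, Fin.cons_succ, pyramidVector, inner_add_left, inner_add_right,
    inner_smul_left, inner_smul_right, inner_axis_basis, inner_basis_axis, inner_axis_axis e hm,
    Complex.conj_ofReal, e.inner_eq_ite, eq_comm (a := l)]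
  rw [Real.sqrt_mul m.cast_nonneg]
  generalize (m : ℝ) = n at hs hsq ⊢
  split_ifs <;> norm_cast <;> field_simp
  · linear_combination √r₁ * hsq
  · ring

variable [FiniteDimensional ℂ H]

theorem IsInformationOptimal.accessibleInformation_eq {E : QEnsemble H m} {M : QObservable H k}
    (h : IsInformationOptimal E M) : accessibleInformation E = mutualInformation E M :=
  IsGreatest.csSup_eq ⟨⟨k, M, rfl⟩, by rintro x ⟨n, N, rfl⟩; exact h n N⟩

theorem exists_inner_eq_norm_sq {T : H →L[ℂ] H} (hT : T.IsPositive) :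
    ∃ B : H →L[ℂ] H, ∀ x, (inner ℂ x (T x)).re = ‖B x‖ ^ 2 := by
  have : CompleteSpace H := FiniteDimensional.complete ℂ H
  obtain ⟨B, rfl⟩ := CStarAlgebra.nonneg_iff_eq_star_mul_self.1
    ((ContinuousLinearMap.nonneg_iff_isPositive T).2 hT)
  refine ⟨B, fun x => ?_⟩
  change (inner ℂ x (ContinuousLinearMap.adjoint B (B x))).re = _
  rw [ContinuousLinearMap.adjoint_inner_right]
  exact inner_self_eq_norm_sq (𝕜 := ℂ) (B x)

theorem QObservable.sum_inner_effect (M : QObservable H k) (x : H) :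
    ∑ l, (inner ℂ x (M.effect l x)).re = ‖x‖ ^ 2 := by
  rw [← Complex.re_sum, ← inner_sum, ← sum_apply, M.effect_sum]
  exact inner_self_eq_norm_sq (𝕜 := ℂ) x

/-- The ensemble of the equiprobable pure states `|ψⱼ⟩⟨ψⱼ|`; the vectors `ψⱼ` are then
automatically unit vectors. -/
structure QEnsemble.IsUniformPure (E : QEnsemble H m) (ψ : Fin m → H) : Prop where
  prob_eq : ∀ j, E.prob j = 1 / m
  state_eq : ∀ j, E.state j = InnerProductSpace.rankOne ℂ (ψ j) (ψ j)

theorem pyramidEnsemble_isUniformPure (e : OrthonormalBasis (Fin m) ℂ H) (hm : 2 ≤ m) {r₀ r₁ : ℝ}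
    (hr₀ : 0 ≤ r₀) (hr₁ : 0 ≤ r₁) (hr : r₀ + ((m : ℝ) - 1) * r₁ = 1) :
    (pyramidEnsemble e hm hr₀ hr₁ hr).IsUniformPure (pyramidVector e r₀ r₁) :=
  ⟨fun _ => rfl, fun _ => rfl⟩

theorem QEnsemble.card_pos (E : QEnsemble H m) : 0 < m := by
  refine Nat.pos_of_ne_zero ?_
  rintro rfl
  simpa using E.prob_sum

namespace QEnsemble.IsUniformPure

variable {E : QEnsemble H m} {ψ : Fin m → H}

theorem norm_sq (hE : E.IsUniformPure ψ) (j : Fin m) : ‖ψ j‖ ^ 2 = 1 := by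
  have h := E.state_trace j
  rw [hE.state_eq, InnerProductSpace.trace_rankOne] at h
  rw [← inner_self_eq_norm_sq (𝕜 := ℂ), h]
  rfl

theorem jointProb_eq (hE : E.IsUniformPure ψ) (M : QObservable H k) (j : Fin m) (l : Fin k) :
    jointProb E M j l = (inner ℂ (ψ j) (M.effect l (ψ j))).re / m := by
  rw [jointProb, hE.prob_eq, hE.state_eq, InnerProductSpace.rankOne_comp,
    InnerProductSpace.trace_rankOne, ContinuousLinearMap.adjoint_inner_left, one_div_mul_eq_div]

theorem sum_sum_sq_eq (hE : E.IsUniformPure ψ) {M : QObservable H k} {x : Fin k → Fin m → ℝ}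
    (hx : ∀ l j, (inner ℂ (ψ j) (M.effect l (ψ j))).re = x l j ^ 2) :
    ∑ l, ∑ j, x l j ^ 2 = m := by
  rw [Finset.sum_comm]
  simp only [← hx, M.sum_inner_effect, hE.norm_sq]
  simp

theorem mutualInformation_mul_log (hE : E.IsUniformPure ψ) {M : QObservable H k}
    {x : Fin k → Fin m → ℝ} (hx : ∀ l j, (inner ℂ (ψ j) (M.effect l (ψ j))).re = x l j ^ 2) :
    mutualInformation E M * Real.log 2 =
      Real.log m + (∑ l, amplitudeNegEntropy (x l)) / m := by
  have hm : (m : ℝ) ≠ 0 := Nat.cast_ne_zero.2 E.card_pos.ne'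
  have hterm (l : Fin k) (j : Fin m) :
      jointProb E M j l * Real.logb 2 (jointProb E M j l / (E.prob j * outputProb E M l)) *
        Real.log 2 = (Real.log m * x l j ^ 2 + (x l j ^ 2 * Real.log (x l j ^ 2) -
          x l j ^ 2 * Real.log (∑ i, x l i ^ 2))) / m := by
    simp only [outputProb, hE.jointProb_eq, hE.prob_eq, hx, ← Finset.sum_div]
    rcases eq_or_ne (x l j) 0 with h | h
    · simp [h]
    have hsq : x l j ^ 2 ≠ 0 := pow_ne_zero 2 h
    have hsum : ∑ i, x l i ^ 2 ≠ 0 := (lt_of_lt_of_le (by positivity) <| Finset.single_le_sum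
      (f := fun i => x l i ^ 2) (fun i _ => sq_nonneg _) (Finset.mem_univ j)).ne'
    rw [mul_assoc, Real.logb, div_mul_cancel₀ _ (Real.log_pos one_lt_two).ne',
      show x l j ^ 2 / m / (1 / m * ((∑ i, x l i ^ 2) / m)) = m * x l j ^ 2 / ∑ i, x l i ^ 2 by
        field_simp,
      Real.log_div (mul_ne_zero hm hsq) hsum, Real.log_mul hm hsq]
    ring
  calc mutualInformation E M * Real.log 2
      = ∑ l, (Real.log m * ∑ j, x l j ^ 2 + amplitudeNegEntropy (x l)) / m := by
        rw [mutualInformation, Finset.sum_comm]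
        simp only [Finset.sum_mul, hterm]
        simp only [← Finset.sum_div, Finset.sum_add_distrib, Finset.sum_sub_distrib,
          amplitudeNegEntropy, ← Finset.mul_sum, ← Finset.sum_mul]
    _ = Real.log m + (∑ l, amplitudeNegEntropy (x l)) / m := by
        rw [← Finset.sum_div, Finset.sum_add_distrib, ← Finset.mul_sum, hE.sum_sum_sq_eq hx,
          add_div, mul_div_cancel_right₀ _ hm]

theorem mutualInformation_mul_log_le (hE : E.IsUniformPure ψ) (hm : 2 ≤ m) {c d : ℝ} (hc : 0 ≤ c)
    (h : ∀ w ∈ Set.Icc 0 1, twoLevelLagrangian (m - 1) c w ≤ d) (M : QObservable H k) :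
    mutualInformation E M * Real.log 2 ≤ Real.log m + (d - c * ‖∑ j, ψ j‖ ^ 2 / m) := by
  have hm1 : (1 : ℝ) < m := Nat.one_lt_cast.2 hm
  choose B hB using fun l => exists_inner_eq_norm_sq (M.effect_pos l)
  have houtcome (l : Fin k) : amplitudeNegEntropy (fun j => ‖B l (ψ j)‖) ≤
      d * ∑ j, ‖B l (ψ j)‖ ^ 2 - c * ‖B l (∑ j, ψ j)‖ ^ 2 := by
    have htriangle : ‖B l (∑ j, ψ j)‖ ≤ ∑ j, ‖B l (ψ j)‖ := map_sum (B l) ψ _ ▸ norm_sum_le _ _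
    have := amplitudeNegEntropy_add_le (x := fun j => ‖B l (ψ j)‖) (sub_pos.2 hm1) (by simp)
      (fun j => norm_nonneg _) h
    refine le_sub_right_of_add_le (le_trans ?_ this)
    gcongr
  have hsum_sq : ∑ l, ‖B l (∑ j, ψ j)‖ ^ 2 = ‖∑ j, ψ j‖ ^ 2 := by
    simp only [← hB, M.sum_inner_effect]
  rw [hE.mutualInformation_mul_log fun l j => hB l (ψ j)]
  gcongr
  calc (∑ l, amplitudeNegEntropy fun j => ‖B l (ψ j)‖) / m
      ≤ (∑ l, (d * ∑ j, ‖B l (ψ j)‖ ^ 2 - c * ‖B l (∑ j, ψ j)‖ ^ 2)) / m := by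
        gcongr with l
        exact houtcome l
    _ = d - c * ‖∑ j, ψ j‖ ^ 2 / m := by
        rw [Finset.sum_sub_distrib, ← Finset.mul_sum, ← Finset.mul_sum, hsum_sq,
          hE.sum_sum_sq_eq fun l j => hB l (ψ j), sub_div, mul_div_cancel_right₀ _ (by positivity)]

end QEnsemble.IsUniformPure

theorem mutualInformation_pyramid_erObservable_mul_log (e : OrthonormalBasis (Fin m) ℂ H)
    (hm : 2 ≤ m) {r₀ r₁ t w : ℝ} (hr₀ : 0 ≤ r₀) (hr₁ : 0 ≤ r₁)
    (hr : r₀ + ((m : ℝ) - 1) * r₁ = 1) (ht : t ∈ Set.Icc (0 : ℝ) 1)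
    (hw : t * √r₀ - √r₁ = w * (t * √r₀ + (m - 1) * √r₁)) :
    mutualInformation (pyramidEnsemble e hm hr₀ hr₁ hr) (erObservable e hm ht) * Real.log 2 =
      (t ^ 2 * r₀ + (m - 1) * r₁) * (Real.log m + twoLevelNegEntropy (m - 1) w) := by
  have hm0 : (0 : ℝ) < m := by positivity
  have ht1 : 0 ≤ 1 - t ^ 2 := sub_nonneg.2 (pow_le_one₀ ht.1 ht.2)
  let x := (t * √r₀ + (m - 1) * √r₁) / √m
  let X : Fin (m + 1) → Fin m → ℝ :=
    Fin.cons (fun _ => √(1 - t ^ 2) * √r₀) fun l j => if j = l then x else w * x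
  have hX (l : Fin (m + 1)) (j : Fin m) :
      inner ℂ (erVector e t l) (pyramidVector e r₀ r₁ j) = (X l j : ℂ) := by
    cases l using Fin.cases with
    | zero => exact inner_erVector_zero_pyramidVector e hm r₀ r₁ t j
    | succ l =>
      rw [inner_erVector_succ_pyramidVector e hm, hw, mul_div_assoc]
      rfl
  have hx : x ^ 2 + (m - 1) * (w * x) ^ 2 = t ^ 2 * r₀ + (m - 1) * r₁ := by
    rw [show w * x = (t * √r₀ - √r₁) / √m by rw [hw, mul_div_assoc], div_pow, div_pow,
      Real.sq_sqrt hm0.le]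
    field_simp
    linear_combination m * t ^ 2 * Real.sq_sqrt hr₀ + m * (m - 1) * Real.sq_sqrt hr₁
  rw [(pyramidEnsemble_isUniformPure e hm hr₀ hr₁ hr).mutualInformation_mul_log (x := X)
    fun l j => inner_rankOne_self_re _ _ (hX l j), Fin.sum_univ_succ]
  simp only [X, Fin.cons_zero, Fin.cons_succ, amplitudeNegEntropy_const,
    amplitudeNegEntropy_twoLevel, Fintype.card_fin, hx, Finset.sum_const, Finset.card_univ,
    nsmul_eq_mul, mul_pow (√(1 - t ^ 2)), Real.sq_sqrt hr₀, Real.sq_sqrt ht1]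
  field_simp
  linear_combination -Real.log m * hr

end Quantum

section PyramidParameters

variable {m r₀ r₁ : ℝ}

theorem sqrt_add_sq_add_mul_sqrt_sub_sq (hr₀ : 0 ≤ r₀) (hr₁ : 0 ≤ r₁)
    (hr : r₀ + (m - 1) * r₁ = 1) :
    (√r₀ + (m - 1) * √r₁) ^ 2 + (m - 1) * (√r₀ - √r₁) ^ 2 = m := by
  linear_combination m * Real.sq_sqrt hr₀ + m * (m - 1) * Real.sq_sqrt hr₁ + m * hr

theorem pos_of_add_mul_eq_one (hm : 1 ≤ m) (hr₀ : 0 ≤ r₀) (h : r₁ ≤ r₀)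
    (hr : r₀ + (m - 1) * r₁ = 1) : 0 < r₀ := by
  refine hr₀.lt_of_ne ?_
  rintro rfl
  nlinarith

theorem sqrt_add_mul_sqrt_pos (hm : 1 ≤ m) (hr₀ : 0 ≤ r₀) (h : r₁ ≤ r₀)
    (hr : r₀ + (m - 1) * r₁ = 1) : 0 < √r₀ + (m - 1) * √r₁ :=
  add_pos_of_pos_of_nonneg (Real.sqrt_pos.2 (pos_of_add_mul_eq_one hm hr₀ h hr))
    (mul_nonneg (sub_nonneg.2 hm) (Real.sqrt_nonneg r₁))

theorem le_four_mul_sub_one_div_sq_iff (hm : 2 ≤ m) (hr₀ : 0 ≤ r₀) (hr₁ : 0 ≤ r₁)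
    (hr : r₀ + (m - 1) * r₁ = 1) :
    r₀ ≤ 4 * (m - 1) / m ^ 2 ↔ (m - 2) * √r₀ ≤ 2 * (m - 1) * √r₁ := by
  have : 0 ≤ m - 1 := by linarith
  have : 0 ≤ m - 2 := by linarith
  have key : (m - 2) ^ 2 * r₀ - (2 * (m - 1)) ^ 2 * r₁ = r₀ * m ^ 2 - 4 * (m - 1) := by
    linear_combination -4 * (m - 1) * hr
  rw [le_div_iff₀ (by positivity), ← sub_nonpos, ← key, sub_nonpos,
    ← sq_le_sq₀ (by positivity : 0 ≤ (m - 2) * √r₀) (by positivity),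
    mul_pow _ (√r₀), mul_pow _ (√r₁), Real.sq_sqrt hr₀, Real.sq_sqrt hr₁]

theorem sub_one_le_sqrt_add_sq_iff (hm : 1 < m) (hr₀ : 0 ≤ r₀) (hr₁ : 0 ≤ r₁) (h : r₁ ≤ r₀)
    (hr : r₀ + (m - 1) * r₁ = 1) :
    m - 1 ≤ (√r₀ + (m - 1) * √r₁) ^ 2 ↔ (m - 2) * √r₀ ≤ 2 * (m - 1) * √r₁ := by
  have hsq := sqrt_add_sq_add_mul_sqrt_sub_sq hr₀ hr₁ hr
  have hm1 := sub_pos.2 hm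
  calc m - 1 ≤ (√r₀ + (m - 1) * √r₁) ^ 2
      ↔ ((m - 1) * (√r₀ - √r₁)) ^ 2 ≤ (√r₀ + (m - 1) * √r₁) ^ 2 := by
        constructor <;> intro <;> nlinarith
    _ ↔ (m - 1) * (√r₀ - √r₁) ≤ √r₀ + (m - 1) * √r₁ :=
        sq_le_sq₀ (mul_nonneg hm1.le (sub_nonneg.2 (Real.sqrt_le_sqrt h))) (by positivity)
    _ ↔ (m - 2) * √r₀ ≤ 2 * (m - 1) * √r₁ := by constructor <;> intro <;> linarith

theorem sqrt_add_sq_le_sub_one_iff (hm : 1 < m) (hr₀ : 0 ≤ r₀) (hr₁ : 0 ≤ r₁) (h : r₁ ≤ r₀)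
    (hr : r₀ + (m - 1) * r₁ = 1) :
    (√r₀ + (m - 1) * √r₁) ^ 2 ≤ m - 1 ↔ 2 * (m - 1) * √r₁ ≤ (m - 2) * √r₀ := by
  have hsq := sqrt_add_sq_add_mul_sqrt_sub_sq hr₀ hr₁ hr
  have hm1 := sub_pos.2 hm
  calc (√r₀ + (m - 1) * √r₁) ^ 2 ≤ m - 1
      ↔ (√r₀ + (m - 1) * √r₁) ^ 2 ≤ ((m - 1) * (√r₀ - √r₁)) ^ 2 := by
        constructor <;> intro <;> nlinarith
    _ ↔ √r₀ + (m - 1) * √r₁ ≤ (m - 1) * (√r₀ - √r₁) :=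
        sq_le_sq₀ (by positivity) (mul_nonneg hm1.le (sub_nonneg.2 (Real.sqrt_le_sqrt h)))
    _ ↔ 2 * (m - 1) * √r₁ ≤ (m - 2) * √r₀ := by constructor <;> intro <;> linarith

end PyramidParameters

section PyramidInformation

variable {m : ℕ} {r₀ r₁ : ℝ}

theorem pyramidP_eq (hm : 0 < m) :
    pyramidP m r₀ r₁ = (√r₀ + (m - 1) * √r₁) ^ 2 / m := by
  have hq := Real.sq_sqrt (Nat.cast_nonneg (α := ℝ) m)
  have : √(m : ℝ) ≠ 0 := by positivity
  rw [pyramidP, Real.sqrt_mul m.cast_nonneg]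
  nth_rw 4 [← hq]
  rw [← div_pow]
  congr 1
  field_simp
  linear_combination √r₁ * hq

theorem one_sub_pyramidP_eq (hm : 0 < m) (hr₀ : 0 ≤ r₀) (hr₁ : 0 ≤ r₁)
    (hr : r₀ + ((m : ℝ) - 1) * r₁ = 1) :
    1 - pyramidP m r₀ r₁ = (m - 1) * ((√r₀ - √r₁) ^ 2 / m) := by
  have hm0 : (m : ℝ) ≠ 0 := by positivity
  rw [pyramidP_eq hm]
  field_simp
  linear_combination -sqrt_add_sq_add_mul_sqrt_sub_sq hr₀ hr₁ hr

theorem pyramidP_mem_Icc (hm : 2 ≤ m) (hr₀ : 0 ≤ r₀) (hr₁ : 0 ≤ r₁)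
    (hr : r₀ + ((m : ℝ) - 1) * r₁ = 1) : pyramidP m r₀ r₁ ∈ Set.Icc (1 / (m : ℝ)) 1 := by
  have hm0 : (0 : ℝ) < m := by positivity
  have hm1 : 0 ≤ (m : ℝ) - 1 := (sub_pos.2 (Nat.one_lt_cast.2 hm)).le
  have hsq := sqrt_add_sq_add_mul_sqrt_sub_sq hr₀ hr₁ hr
  rw [pyramidP_eq (by positivity), Set.mem_Icc, div_le_div_iff_of_pos_right hm0, div_le_one hm0]
  refine ⟨?_, (le_add_of_nonneg_right (by positivity)).trans_eq hsq⟩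
  have : 0 ≤ (m - 1) * (√r₁ * (2 * √r₀ + (m - 2) * √r₁)) := by
    have : 0 ≤ (m : ℝ) - 2 := sub_nonneg.2 (Nat.ofNat_le_cast.2 hm)
    positivity
  linear_combination this - Real.sq_sqrt hr₀ - (m - 1) * Real.sq_sqrt hr₁ - hr

theorem srmInformation_eq_pyramidP (hm : 2 ≤ m) (hr₀ : 0 ≤ r₀) (hr₁ : 0 ≤ r₁)
    (hr : r₀ + ((m : ℝ) - 1) * r₁ = 1) :
    srmInformation m r₀ r₁ = Real.logb 2 m + pyramidP m r₀ r₁ * Real.logb 2 (pyramidP m r₀ r₁) +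
      (1 - pyramidP m r₀ r₁) * Real.logb 2 ((1 - pyramidP m r₀ r₁) / ((m : ℝ) - 1)) := by
  have hm0 : (m : ℝ) ≠ 0 := by positivity
  have hm1 : (m : ℝ) - 1 ≠ 0 := (sub_pos.2 (Nat.one_lt_cast.2 hm)).ne'
  have hlog (y : ℝ) :
      y ^ 2 / m * Real.logb 2 (y ^ 2 / m) = y ^ 2 / m * (Real.logb 2 (y ^ 2) - Real.logb 2 m) := by
    rcases eq_or_ne y 0 with rfl | hy
    · simp
    · rw [Real.logb_div (pow_ne_zero 2 hy) hm0]
  rw [one_sub_pyramidP_eq (by positivity) hr₀ hr₁ hr, mul_div_cancel_left₀ _ hm1, mul_assoc, hlog,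
    pyramidP_eq (by positivity), hlog, srmInformation]
  field_simp
  linear_combination Real.logb 2 m * sqrt_add_sq_add_mul_sqrt_sub_sq hr₀ hr₁ hr

theorem sqrt_pyramidP_sub_sqrt_sq (hm : 2 ≤ m) (hr₀ : 0 ≤ r₀) (hr₁ : 0 ≤ r₁) (h : r₁ ≤ r₀)
    (hr : r₀ + ((m : ℝ) - 1) * r₁ = 1) :
    (√(pyramidP m r₀ r₁) - √((1 - pyramidP m r₀ r₁) / ((m : ℝ) - 1))) ^ 2 = m * r₁ := by
  have hm0 : (0 : ℝ) < m := by positivity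
  have hm1 : 0 < (m : ℝ) - 1 := sub_pos.2 (Nat.one_lt_cast.2 hm)
  rw [one_sub_pyramidP_eq (by positivity) hr₀ hr₁ hr, mul_div_cancel_left₀ _ hm1.ne',
    pyramidP_eq (by positivity), Real.sqrt_div (sq_nonneg _), Real.sqrt_div (sq_nonneg _),
    Real.sqrt_sq (by positivity), Real.sqrt_sq (sub_nonneg.2 (Real.sqrt_le_sqrt h)), ← sub_div,
    div_pow, Real.sq_sqrt hm0.le, div_eq_iff hm0.ne']
  linear_combination m ^ 2 * Real.sq_sqrt hr₁

theorem srmInformation_mul_log (hm : 1 ≤ m) (hr₀ : 0 ≤ r₀) (hr₁ : 0 ≤ r₁) (h : r₁ ≤ r₀)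
    (hr : r₀ + ((m : ℝ) - 1) * r₁ = 1) :
    srmInformation m r₀ r₁ * Real.log 2 = Real.log m +
      twoLevelNegEntropy (m - 1) ((√r₀ - √r₁) / (√r₀ + (m - 1) * √r₁)) := by
  have hm1 : (1 : ℝ) ≤ m := Nat.one_le_cast.2 hm
  have hm0 : (m : ℝ) ≠ 0 := by positivity
  have hα := (sqrt_add_mul_sqrt_pos hm1 hr₀ h hr).ne'
  have hentropy := mul_twoLevelNegEntropy (sub_nonneg.2 hm1)
    ((√r₀ - √r₁) / (√r₀ + (m - 1) * √r₁)) (√r₀ + (m - 1) * √r₁)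
  rw [div_mul_cancel₀ _ hα, sqrt_add_sq_add_mul_sqrt_sub_sq hr₀ hr₁ hr] at hentropy
  have hlog : Real.log 2 ≠ 0 := (Real.log_pos one_lt_two).ne'
  refine mul_left_cancel₀ hm0 ?_
  rw [mul_add, hentropy, srmInformation, Real.logb, Real.logb]
  field_simp
  ring

theorem ratio_parameter_mul_sqrt (m : ℕ) {r₀ r₁ : ℝ} (hr₀ : 0 < r₀) :
    2 * ((m : ℝ) - 1) / ((m : ℝ) - 2) * √(r₁ / r₀) * √r₀ =
      2 * ((m : ℝ) - 1) / ((m : ℝ) - 2) * √r₁ := by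
  rw [mul_assoc, ← Real.sqrt_mul' _ hr₀.le, div_mul_cancel₀ _ hr₀.ne']

theorem ratio_parameter_mem_Icc (hm : 2 < m) (hr₀ : 0 < r₀)
    (h : 2 * ((m : ℝ) - 1) * √r₁ ≤ (m - 2) * √r₀) :
    2 * ((m : ℝ) - 1) / ((m : ℝ) - 2) * √(r₁ / r₀) ∈ Set.Icc (0 : ℝ) 1 := by
  have hm2 : 0 < (m : ℝ) - 2 := sub_pos.2 (Nat.ofNat_lt_cast.2 hm)
  have hm1 : 0 < (m : ℝ) - 1 := by linarith
  refine ⟨by positivity, le_of_mul_le_mul_right ?_ (Real.sqrt_pos.2 hr₀)⟩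
  rw [ratio_parameter_mul_sqrt m hr₀, one_mul, div_mul_eq_mul_div, div_le_iff₀ hm2, mul_comm (√r₀)]
  exact h

theorem three_le_and_ratio_le_of_lt (hm : 2 ≤ m) (hr₀ : 0 ≤ r₀) (hr₁ : 0 ≤ r₁)
    (hr : r₀ + ((m : ℝ) - 1) * r₁ = 1) (h : 4 * ((m : ℝ) - 1) / (m : ℝ) ^ 2 < r₀) :
    3 ≤ m ∧ 2 * ((m : ℝ) - 1) * √r₁ ≤ (m - 2) * √r₀ := by
  have hm2 : (2 : ℝ) ≤ m := Nat.ofNat_le_cast.2 hm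
  rw [← not_le, le_four_mul_sub_one_div_sq_iff hm2 hr₀ hr₁ hr, not_le] at h
  have hpos : 0 < ((m : ℝ) - 2) * √r₀ := lt_of_le_of_lt
    (mul_nonneg (by linarith) (Real.sqrt_nonneg r₁)) h
  have : (2 : ℝ) < m := sub_pos.1 (pos_of_mul_pos_left hpos (Real.sqrt_nonneg r₀))
  exact ⟨Nat.ofNat_lt_cast.1 this, h.le⟩

theorem optimalParameter_mem_Icc (hm : 2 ≤ m) (hr₀ : 0 ≤ r₀) (hr₁ : 0 ≤ r₁)
    (hr : r₀ + ((m : ℝ) - 1) * r₁ = 1) (h : r₁ ≤ r₀) :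
    optimalParameter m r₀ r₁ ∈ Set.Icc (0 : ℝ) 1 := by
  rw [optimalParameter]
  split_ifs with hthr
  · exact Set.right_mem_Icc.2 zero_le_one
  · obtain ⟨hm3, hratio⟩ := three_le_and_ratio_le_of_lt hm hr₀ hr₁ hr (not_le.1 hthr)
    exact ratio_parameter_mem_Icc hm3
      (pos_of_add_mul_eq_one (Nat.one_le_cast.2 (one_le_two.trans hm)) hr₀ h hr) hratio

end PyramidInformation

section PyramidOptimality

variable {H : Type*} [NormedAddCommGroup H] [InnerProductSpace ℂ H] [FiniteDimensional ℂ H]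
  {m k : ℕ} (e : OrthonormalBasis (Fin m) ℂ H) (hm : 2 ≤ m) {r₀ r₁ t : ℝ} (hr₀ : 0 ≤ r₀)
  (hr₁ : 0 ≤ r₁) (hr : r₀ + ((m : ℝ) - 1) * r₁ = 1)

theorem mutualInformation_pyramid_mul_log_le {c d : ℝ} (hc : 0 ≤ c)
    (h : ∀ w ∈ Set.Icc 0 1, twoLevelLagrangian (m - 1) c w ≤ d) (M : QObservable H k) :
    mutualInformation (pyramidEnsemble e hm hr₀ hr₁ hr) M * Real.log 2 ≤
      Real.log m + (d - c * (m * r₀)) := by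
  have hm0 : (m : ℝ) ≠ 0 := by positivity
  have := (pyramidEnsemble_isUniformPure e hm hr₀ hr₁ hr).mutualInformation_mul_log_le hm hc h M
  rwa [norm_sum_pyramidVector_sq e hm hr₀, sq, mul_assoc (m : ℝ), mul_left_comm c,
    mul_div_cancel_left₀ _ hm0] at this

theorem mutualInformation_pyramid_le_srmInformation (h : r₁ ≤ r₀)
    (hsrm : ((m : ℝ) - 2) * √r₀ ≤ 2 * (m - 1) * √r₁) (M : QObservable H k) :
    mutualInformation (pyramidEnsemble e hm hr₀ hr₁ hr) M ≤ srmInformation m r₀ r₁ := by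
  have hm0 : (m : ℝ) ≠ 0 := by positivity
  have hn : (1 : ℝ) ≤ m - 1 := by linarith [(Nat.ofNat_le_cast.2 hm : (2 : ℝ) ≤ m)]
  have hα : 0 < √r₀ + (m - 1) * √r₁ := sqrt_add_mul_sqrt_pos (by linarith) hr₀ h hr
  let w := (√r₀ - √r₁) / (√r₀ + (m - 1) * √r₁)
  have hw : 0 ≤ w := div_nonneg (sub_nonneg.2 (Real.sqrt_le_sqrt h)) hα.le
  have hnw : (m - 1) * w ≤ 1 := by
    rw [← mul_div_assoc, div_le_one hα]
    linarith
  have hoverlap : twoLevelOverlap (m - 1) w = m * r₀ := by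
    have := mul_twoLevelOverlap (zero_le_one.trans hn) w (√r₀ + (m - 1) * √r₁)
    rw [div_mul_cancel₀ _ hα.ne', sqrt_add_sq_add_mul_sqrt_sub_sq hr₀ hr₁ hr] at this
    refine mul_left_cancel₀ hm0 (this.trans ?_)
    linear_combination (m : ℝ) ^ 2 * Real.sq_sqrt hr₀
  obtain ⟨c, hc, hle⟩ := exists_twoLevelLagrangian_le hn hw hnw
  refine le_of_mul_le_mul_right ?_ (Real.log_pos one_lt_two)
  refine (mutualInformation_pyramid_mul_log_le e hm hr₀ hr₁ hr hc hle M).trans_eq ?_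
  rw [twoLevelLagrangian, hoverlap, add_sub_cancel_right,
    srmInformation_mul_log (one_le_two.trans hm) hr₀ hr₁ h hr]

theorem mutualInformation_pyramid_erObservable_one (h : r₁ ≤ r₀) (ht : (1 : ℝ) ∈ Set.Icc 0 1) :
    mutualInformation (pyramidEnsemble e hm hr₀ hr₁ hr) (erObservable e hm ht) =
      srmInformation m r₀ r₁ := by
  have hα := sqrt_add_mul_sqrt_pos (Nat.one_le_cast.2 (one_le_two.trans hm)) hr₀ h hr
  refine mul_right_cancel₀ (Real.log_pos one_lt_two).ne' ?_
  rw [mutualInformation_pyramid_erObservable_mul_log e hm hr₀ hr₁ hr ht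
    (w := (√r₀ - √r₁) / (√r₀ + (m - 1) * √r₁)) (by rw [one_mul, div_mul_cancel₀ _ hα.ne']),
    srmInformation_mul_log (one_le_two.trans hm) hr₀ hr₁ h hr, one_pow, one_mul, hr, one_mul]

theorem mutualInformation_pyramid_le (hm3 : 3 ≤ m) (M : QObservable H k) :
    mutualInformation (pyramidEnsemble e hm hr₀ hr₁ hr) M ≤
      m * (1 - r₀) / ((m : ℝ) - 2) * Real.logb 2 ((m : ℝ) - 1) := by
  have hm2 : (3 : ℝ) ≤ m := Nat.ofNat_le_cast.2 hm3
  have hn : (0 : ℝ) < m - 1 := by linarith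
  have hinv : (m - 1 : ℝ) * (m - 1 : ℝ)⁻¹ = 1 := mul_inv_cancel₀ hn.ne'
  have hinv1 : (m - 1 : ℝ)⁻¹ < 1 := inv_lt_one_of_one_lt₀ (by linarith)
  refine le_of_mul_le_mul_right ?_ (Real.log_pos one_lt_two)
  refine (mutualInformation_pyramid_mul_log_le e hm hr₀ hr₁ hr
    (twoLevelMultiplier_nonneg hn.le (inv_nonneg.2 hn.le) hinv1.le)
    (fun w => twoLevelLagrangian_le (by linarith) (inv_nonneg.2 hn.le) hinv1 hinv.le) M).trans_eq ?_
  have hm2' : (m : ℝ) - 2 ≠ 0 := by linarith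
  rw [twoLevelLagrangian, twoLevelNegEntropy_inv hn, twoLevelOverlap_inv hn,
    twoLevelMultiplier_inv hn.ne', Real.logb, add_sub_cancel, sub_sub, one_add_one_eq_two]
  field_simp
  ring

theorem mutualInformation_pyramid_erObservable (hm3 : 3 ≤ m) (ht : t ∈ Set.Icc (0 : ℝ) 1)
    (htr : t * √r₀ = 2 * ((m : ℝ) - 1) / ((m : ℝ) - 2) * √r₁) :
    mutualInformation (pyramidEnsemble e hm hr₀ hr₁ hr) (erObservable e hm ht) =
      m * (1 - r₀) / ((m : ℝ) - 2) * Real.logb 2 ((m : ℝ) - 1) := by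
  have hm2 : (3 : ℝ) ≤ m := Nat.ofNat_le_cast.2 hm3
  have hn : (0 : ℝ) < m - 1 := by linarith
  have hm2' : (m : ℝ) - 2 ≠ 0 := by linarith
  have hratio : t * √r₀ - √r₁ = (m - 1 : ℝ)⁻¹ * (t * √r₀ + (m - 1) * √r₁) := by
    rw [htr]
    field_simp
    ring
  have hweight : t ^ 2 * r₀ = (2 * ((m : ℝ) - 1) / ((m : ℝ) - 2)) ^ 2 * r₁ := by
    rw [← Real.sq_sqrt hr₀, ← Real.sq_sqrt hr₁, ← mul_pow, ← mul_pow, htr]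
  refine mul_right_cancel₀ (Real.log_pos one_lt_two).ne' ?_
  rw [mutualInformation_pyramid_erObservable_mul_log e hm hr₀ hr₁ hr ht hratio, hweight,
    twoLevelNegEntropy_inv hn, Real.logb, add_sub_cancel, sub_sub, one_add_one_eq_two,
    show 1 - r₀ = (m - 1) * r₁ by linear_combination -hr]
  field_simp
  ring

theorem isInformationOptimal_erObservable_one (h : r₁ ≤ r₀)
    (hsrm : ((m : ℝ) - 2) * √r₀ ≤ 2 * (m - 1) * √r₁) (ht : (1 : ℝ) ∈ Set.Icc 0 1) :
    IsInformationOptimal (pyramidEnsemble e hm hr₀ hr₁ hr) (erObservable e hm ht) := fun _ N =>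
  (mutualInformation_pyramid_le_srmInformation e hm hr₀ hr₁ hr h hsrm N).trans_eq
    (mutualInformation_pyramid_erObservable_one e hm hr₀ hr₁ hr h ht).symm

theorem isInformationOptimal_erObservable (hm3 : 3 ≤ m) (ht : t ∈ Set.Icc (0 : ℝ) 1)
    (htr : t * √r₀ = 2 * ((m : ℝ) - 1) / ((m : ℝ) - 2) * √r₁) :
    IsInformationOptimal (pyramidEnsemble e hm hr₀ hr₁ hr) (erObservable e hm ht) := fun _ N =>
  (mutualInformation_pyramid_le e hm hr₀ hr₁ hr hm3 N).trans_eq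
    (mutualInformation_pyramid_erObservable e hm hr₀ hr₁ hr hm3 ht htr).symm

theorem accessibleInformation_pyramid_eq_srmInformation (h : r₁ ≤ r₀)
    (hsrm : ((m : ℝ) - 2) * √r₀ ≤ 2 * (m - 1) * √r₁) :
    accessibleInformation (pyramidEnsemble e hm hr₀ hr₁ hr) = srmInformation m r₀ r₁ := by
  have ht : (1 : ℝ) ∈ Set.Icc 0 1 := Set.right_mem_Icc.2 zero_le_one
  rw [(isInformationOptimal_erObservable_one e hm hr₀ hr₁ hr h hsrm ht).accessibleInformation_eq,
    mutualInformation_pyramid_erObservable_one e hm hr₀ hr₁ hr h ht]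

theorem accessibleInformation_pyramid_of_ratio_le (h : r₁ ≤ r₀) (hm3 : 3 ≤ m)
    (hratio : 2 * ((m : ℝ) - 1) * √r₁ ≤ (m - 2) * √r₀) :
    accessibleInformation (pyramidEnsemble e hm hr₀ hr₁ hr) =
      m * (1 - r₀) / ((m : ℝ) - 2) * Real.logb 2 ((m : ℝ) - 1) := by
  have hr₀' := pos_of_add_mul_eq_one (Nat.one_le_cast.2 (one_le_two.trans hm)) hr₀ h hr
  have ht := ratio_parameter_mem_Icc hm3 hr₀' hratio
  have htr := ratio_parameter_mul_sqrt m (r₁ := r₁) hr₀'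
  rw [(isInformationOptimal_erObservable e hm hr₀ hr₁ hr hm3 ht htr).accessibleInformation_eq,
    mutualInformation_pyramid_erObservable e hm hr₀ hr₁ hr hm3 ht htr]

theorem accessibleInformation_pyramid_of_sub_one_div_le_pyramidP (h : r₁ ≤ r₀)
    (hp : ((m : ℝ) - 1) / m ≤ pyramidP m r₀ r₁) :
    accessibleInformation (pyramidEnsemble e hm hr₀ hr₁ hr) =
      Real.logb 2 m + pyramidP m r₀ r₁ * Real.logb 2 (pyramidP m r₀ r₁) +
        (1 - pyramidP m r₀ r₁) * Real.logb 2 ((1 - pyramidP m r₀ r₁) / ((m : ℝ) - 1)) := by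
  have hm0 : (0 : ℝ) < m := by positivity
  rw [pyramidP_eq (by positivity), div_le_div_iff_of_pos_right hm0,
    sub_one_le_sqrt_add_sq_iff (Nat.one_lt_cast.2 hm) hr₀ hr₁ h hr] at hp
  rw [accessibleInformation_pyramid_eq_srmInformation e hm hr₀ hr₁ hr h hp,
    srmInformation_eq_pyramidP hm hr₀ hr₁ hr]

theorem accessibleInformation_pyramid_of_pyramidP_le (h : r₁ ≤ r₀) (hm3 : 3 ≤ m)
    (hp : pyramidP m r₀ r₁ ≤ ((m : ℝ) - 1) / m) :
    accessibleInformation (pyramidEnsemble e hm hr₀ hr₁ hr) =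
      ((m : ℝ) - 1) / ((m : ℝ) - 2) * Real.logb 2 ((m : ℝ) - 1) *
        (√(pyramidP m r₀ r₁) - √((1 - pyramidP m r₀ r₁) / ((m : ℝ) - 1))) ^ 2 := by
  have hm0 : (0 : ℝ) < m := by positivity
  rw [pyramidP_eq (by positivity), div_le_div_iff_of_pos_right hm0,
    sqrt_add_sq_le_sub_one_iff (Nat.one_lt_cast.2 hm) hr₀ hr₁ h hr] at hp
  rw [accessibleInformation_pyramid_of_ratio_le e hm hr₀ hr₁ hr h hm3 hp,
    sqrt_pyramidP_sub_sqrt_sq hm hr₀ hr₁ h hr, show 1 - r₀ = (m - 1) * r₁ by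
      linear_combination -hr]
  ring

theorem isInformationOptimal_erObservable_optimalParameter (h : r₁ ≤ r₀)
    (ht : optimalParameter m r₀ r₁ ∈ Set.Icc (0 : ℝ) 1) :
    IsInformationOptimal (pyramidEnsemble e hm hr₀ hr₁ hr) (erObservable e hm ht) := by
  by_cases hthr : r₀ ≤ 4 * ((m : ℝ) - 1) / (m : ℝ) ^ 2
  · revert ht
    rw [optimalParameter, if_pos hthr]
    exact isInformationOptimal_erObservable_one e hm hr₀ hr₁ hr h
      ((le_four_mul_sub_one_div_sq_iff (Nat.ofNat_le_cast.2 hm) hr₀ hr₁ hr).1 hthr)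
  · have hm3 := (three_le_and_ratio_le_of_lt hm hr₀ hr₁ hr (not_le.1 hthr)).1
    refine isInformationOptimal_erObservable e hm hr₀ hr₁ hr hm3 ht ?_
    rw [optimalParameter, if_neg hthr]
    exact ratio_parameter_mul_sqrt m
      (pos_of_add_mul_eq_one (Nat.one_le_cast.2 (one_le_two.trans hm)) hr₀ h hr)

theorem accessibleInformation_pyramid (h : r₁ ≤ r₀) :
    accessibleInformation (pyramidEnsemble e hm hr₀ hr₁ hr) =
      if r₀ ≤ 4 * ((m : ℝ) - 1) / (m : ℝ) ^ 2 then srmInformation m r₀ r₁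
      else (m : ℝ) * (1 - r₀) / ((m : ℝ) - 2) * Real.logb 2 ((m : ℝ) - 1) := by
  split_ifs with hthr
  · exact accessibleInformation_pyramid_eq_srmInformation e hm hr₀ hr₁ hr h
      ((le_four_mul_sub_one_div_sq_iff (Nat.ofNat_le_cast.2 hm) hr₀ hr₁ hr).1 hthr)
  · obtain ⟨hm3, hratio⟩ := three_le_and_ratio_le_of_lt hm hr₀ hr₁ hr (not_le.1 hthr)
    exact accessibleInformation_pyramid_of_ratio_le e hm hr₀ hr₁ hr h hm3 hratio

end PyramidOptimality

theorem corollary1 {m : ℕ} (hm : 2 ≤ m)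
    {H : Type*} [NormedAddCommGroup H] [InnerProductSpace ℂ H] [FiniteDimensional ℂ H]
    (e : OrthonormalBasis (Fin m) ℂ H) (r₀ r₁ : ℝ)
    (hr₀ : 0 ≤ r₀) (hr₁ : 0 ≤ r₁) (hr : r₀ + ((m : ℝ) - 1) * r₁ = 1) (hacute : r₁ ≤ r₀) :
    -- the observable with parameter `t_a(m)` is information-optimal
    (∃ ht : optimalParameter m r₀ r₁ ∈ Set.Icc (0 : ℝ) 1,
      IsInformationOptimal (pyramidEnsemble e hm hr₀ hr₁ hr) (erObservable e hm ht) ∧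
      accessibleInformation (pyramidEnsemble e hm hr₀ hr₁ hr) =
        mutualInformation (pyramidEnsemble e hm hr₀ hr₁ hr) (erObservable e hm ht)) ∧
    -- the accessible information in terms of the parameter `p`
    pyramidP m r₀ r₁ ∈ Set.Icc (1 / (m : ℝ)) 1 ∧
    (∀ p : ℝ, p = pyramidP m r₀ r₁ →
      (p ∈ Set.Icc (((m : ℝ) - 1) / m) 1 →
        accessibleInformation (pyramidEnsemble e hm hr₀ hr₁ hr) =
          Real.logb 2 m + p * Real.logb 2 p
            + (1 - p) * Real.logb 2 ((1 - p) / ((m : ℝ) - 1))) ∧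
      (3 ≤ m → p ∈ Set.Icc (1 / (m : ℝ)) (((m : ℝ) - 1) / m) →
        accessibleInformation (pyramidEnsemble e hm hr₀ hr₁ hr) =
          ((m : ℝ) - 1) / ((m : ℝ) - 2) * Real.logb 2 ((m : ℝ) - 1)
            * (√p - √((1 - p) / ((m : ℝ) - 1))) ^ 2)) ∧
    -- the conjectured value, in terms of `r₀` and `r₁`
    accessibleInformation (pyramidEnsemble e hm hr₀ hr₁ hr) =
      (if r₀ ≤ 4 * ((m : ℝ) - 1) / (m : ℝ) ^ 2 then srmInformation m r₀ r₁
       else (m : ℝ) * (1 - r₀) / ((m : ℝ) - 2) * Real.logb 2 ((m : ℝ) - 1)) := by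
  have ht := optimalParameter_mem_Icc hm hr₀ hr₁ hr hacute
  have hopt := isInformationOptimal_erObservable_optimalParameter e hm hr₀ hr₁ hr hacute ht
  refine ⟨⟨ht, hopt, hopt.accessibleInformation_eq⟩, pyramidP_mem_Icc hm hr₀ hr₁ hr, ?_,
    accessibleInformation_pyramid e hm hr₀ hr₁ hr hacute⟩
  rintro p rfl
  exact ⟨fun hp =>
      accessibleInformation_pyramid_of_sub_one_div_le_pyramidP e hm hr₀ hr₁ hr hacute hp.1,
    fun hm3 hp => accessibleInformation_pyramid_of_pyramidP_le e hm hr₀ hr₁ hr hacute hm3 hp.2⟩
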